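/- Let $n\ge 1$, let $\Omega\subset\mathbb{R}^n$ be a bounded domain (nonempty, open, connected), let $p\in(1,\infty)$, let $V$ be a real Banach space with dual $V^*$, and let $X$ be a complete metric space. **Definitions.** $L^p(\Omega;X)$ is the set of Lebesgue measurable, essentially separably valued $f\colon\Omega\to X$ with $d(f(\cdot),z_0)\in L^p(\Omega)$ for every $z_0\in X$. The upper integral $\overline{\int}_\Omega F$ of $F\ge 0$ is the infimum of $\int_\Omega h$ over all $h\in L^1(\Omega)$ with $F\le h$ on $\Omega$ ($\infty$ if there is none). $L^p_*(\Omega;V^*)$ is the set of weak* measurable $f\colon\Omega\to V^*$ (i.e. $f_v:=\langle v,f(\cdot)\rangle$ is Lebesgue measurable for every $v\in V$) with $\overline{\int}_\Omega\|f(x)\|^p\,dx<\infty$. A function $f^j\colon\Omega\to V^*$ is a $j$-th *weak weak\* derivative* of $f$ if $$\int_\Omega \frac{\partial\varphi}{\partial x_j}(x)\, f(x)\,dx=-\int_\Omega\varphi(x)\, f^j(x)\,dx\qquad\text{for all }\varphi\in C_0^\infty(\Omega)$$ as Gelfand integrals, where $\Lambda\in V^*$ is the Gelfand integral of $F$ if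 $F_v$ is integrable and $\langle v,\Lambda\rangle=\int_\Omega F_v$ for every $v\in V$. $W^{1,p}_*(\Omega;V^*)$ is the set of $f\in L^p(\Omega;V^*)$ that have a $j$-th weak weak* derivative in $L^p_*(\Omega;V^*)$ for every $j=1,\dots,n$. A function $g\in L^p(\Omega)$ is a *Reshetnyak upper gradient* of $f\colon\Omega\to X$ if for every $L\ge 0$ and every $L$-Lipschitz $\varphi\colon X\to\mathbb{R}$ the function $\varphi\circ f$ has a weak gradient with $|\nabla(\varphi\circ f)|\le L\,g$ a.e. on $\Omega$. $W^{1,p}(\Omega;X)$ is the set of $f\in L^p(\Omega;X)$ that have a Reshetnyak upper gradient and for which $\varphi\circ f\in W^{1,p}(\Omega)$ for every Lipschitz $\varphi\colon X\to\mathbb{R}$. For $q\in[2,\infty]$ put $$\|f\|_{W^{1,p}}=\|f\|_{L^p}+\inf_g\|g\|_{L^p},\qquad \|f\|_{W^{1,p}_*}=\|f\|_{L^p}+\inf_{(f^1,\dots,f^n)}\Big(\overline{\int}_\Omega |(f^1(x),\dots,f^n(x))|_q^p\,dx\Big)^{1/p},$$ where $g$ ranges over the Reshetnyak upper gradients of $f$,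 $f^j$ over the $j$-th weak weak* derivatives of $f$ in $L^p_*(\Omega;V^*)$, and $|\cdot|_q$ is the $\ell^q$ product norm on $(V^*)^n$ (Euclidean for $q=2$, maximum for $q=\infty$). **Theorem.** 1. $W^{1,p}_*(\Omega;V^*)=W^{1,p}(\Omega;V^*)$. 2. If $g$ is a Reshetnyak upper gradient of $f\in W^{1,p}(\Omega;V^*)$, then for every $j$ the map $f$ has a $j$-th weak weak* derivative $f^j\in L^p_*(\Omega;V^*)$ with $\|f^j(x)\|\le g(x)$ for a.e. $x\in\Omega$. 3. For every $f\in W^{1,p}(\Omega;V^*)$ and every $q\in[2,\infty]$, $$\tfrac1{\sqrt n}\,\|f\|_{W^{1,p}}\le\|f\|_{W^{1,p}_*}\le\sqrt n\,\|f\|_{W^{1,p}}.$$ 4. For every isometric embedding $\iota\colon X\to V^*$ one has $\{u\colon\Omega\to X \mid \iota\circ u\in W^{1,p}_*(\Omega;V^*)\}=W^{1,p}(\Omega;X)$; and $X$ has an isometric embedding into some dual Banach space. -/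

import Mathlib

open MeasureTheory
open scoped ENNReal NNReal ContDiff

universe u v

noncomputable section

namespace WeakStarSobolev

/-- Test functions `φ ∈ C₀^∞(Ω)`: smooth functions with compact support contained in `Ω`. -/
def IsTestFunction {n : ℕ} (Ω : Set (EuclideanSpace ℝ (Fin n)))
    (φ : EuclideanSpace ℝ (Fin n) → ℝ) : Prop :=
  ContDiff ℝ ∞ φ ∧ HasCompactSupport φ ∧ tsupport φ ⊆ Ω

/-- The classical partial derivative `∂φ/∂x_j`. -/
def partialDeriv {n : ℕ} (j : Fin n) (φ : EuclideanSpace ℝ (Fin n) → ℝ)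
    (x : EuclideanSpace ℝ (Fin n)) : ℝ :=
  fderiv ℝ φ x (EuclideanSpace.single j 1)

/-! ### Real-valued Sobolev functions

Functions on `Ω` are represented by functions on the whole space; every notion below depends only
on their values on `Ω`. -/

/-- `u'` is a `j`-th weak partial derivative of the real-valued function `u` on `Ω`. -/
def HasWeakPartialDeriv {n : ℕ} (Ω : Set (EuclideanSpace ℝ (Fin n))) (j : Fin n)
    (u u' : EuclideanSpace ℝ (Fin n) → ℝ) : Prop :=
  LocallyIntegrableOn u Ω ∧ LocallyIntegrableOn u' Ω ∧
    ∀ φ : EuclideanSpace ℝ (Fin n) → ℝ, IsTestFunction Ω φ →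
      ∫ x in Ω, partialDeriv j φ x * u x = -∫ x in Ω, φ x * u' x

/-- The classical Sobolev space `W^{1,p}(Ω)` of real-valued functions. -/
def sobolevReal {n : ℕ} (Ω : Set (EuclideanSpace ℝ (Fin n))) (p : ℝ≥0∞) :
    Set (EuclideanSpace ℝ (Fin n) → ℝ) :=
  {u | MemLp u p (volume.restrict Ω) ∧
    ∀ j : Fin n, ∃ u' : EuclideanSpace ℝ (Fin n) → ℝ,
      MemLp u' p (volume.restrict Ω) ∧ HasWeakPartialDeriv Ω j u u'}

/-- `G = ∇u` is a weak gradient of `u` on `Ω`. -/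
def HasWeakGradient {n : ℕ} (Ω : Set (EuclideanSpace ℝ (Fin n)))
    (u : EuclideanSpace ℝ (Fin n) → ℝ)
    (G : EuclideanSpace ℝ (Fin n) → EuclideanSpace ℝ (Fin n)) : Prop :=
  ∀ j : Fin n, HasWeakPartialDeriv Ω j u (fun x => G x j)

/-! ### The Reshetnyak Sobolev space of metric-space-valued maps -/

/-- `f ∈ L^p(Ω; X)`: `f` is Lebesgue measurable and essentially separably valued (which together
is `AEStronglyMeasurable`), and `x ↦ d(f(x), z₀)` is in `L^p(Ω)` for every `z₀ ∈ X`. -/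
def MemLpMetric {n : ℕ} (Ω : Set (EuclideanSpace ℝ (Fin n))) (p : ℝ≥0∞)
    {X : Type*} [MetricSpace X] (f : EuclideanSpace ℝ (Fin n) → X) : Prop :=
  AEStronglyMeasurable f (volume.restrict Ω) ∧
    ∀ z₀ : X, MemLp (fun x => dist (f x) z₀) p (volume.restrict Ω)

/-- `g ∈ L^p(Ω)` is a Reshetnyak upper gradient of `f`: `|∇(φ ∘ f)| ≤ L * g` almost everywhere on
`Ω` for every `L`-Lipschitz function `φ : X → ℝ`. -/
def IsReshetnyakUpperGradient {n : ℕ} (Ω : Set (EuclideanSpace ℝ (Fin n))) (p : ℝ≥0∞)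
    {X : Type*} [MetricSpace X] (f : EuclideanSpace ℝ (Fin n) → X)
    (g : EuclideanSpace ℝ (Fin n) → ℝ) : Prop :=
  MemLp g p (volume.restrict Ω) ∧
    ∀ (L : ℝ≥0) (φ : X → ℝ), LipschitzWith L φ →
      ∃ G : EuclideanSpace ℝ (Fin n) → EuclideanSpace ℝ (Fin n),
        HasWeakGradient Ω (φ ∘ f) G ∧ ∀ᵐ x ∂(volume.restrict Ω), ‖G x‖ ≤ L * g x

/-- The Reshetnyak Sobolev space `W^{1,p}(Ω; X)`. -/
def sobolevReshetnyak {n : ℕ} (Ω : Set (EuclideanSpace ℝ (Fin n))) (p : ℝ≥0∞)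
    (X : Type*) [MetricSpace X] : Set (EuclideanSpace ℝ (Fin n) → X) :=
  {f | MemLpMetric Ω p f ∧
    (∀ (L : ℝ≥0) (φ : X → ℝ), LipschitzWith L φ → φ ∘ f ∈ sobolevReal Ω p) ∧
    ∃ g : EuclideanSpace ℝ (Fin n) → ℝ, IsReshetnyakUpperGradient Ω p f g}

/-! ### The weak* Sobolev space of maps with values in a dual Banach space -/

/-- The upper integral over `Ω` of a nonnegative function: the infimum of the integrals of its
integrable majorants (`∞` if there is none). -/
def upperIntegral {n : ℕ} (Ω : Set (EuclideanSpace ℝ (Fin n)))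
    (F : EuclideanSpace ℝ (Fin n) → ℝ) : ℝ≥0∞ :=
  ⨅ (h : EuclideanSpace ℝ (Fin n) → ℝ) (_ : IntegrableOn h Ω) (_ : ∀ x ∈ Ω, F x ≤ h x),
    ENNReal.ofReal (∫ x in Ω, h x)

section Dual

variable {V : Type*} [NormedAddCommGroup V] [NormedSpace ℝ V]

/-- `f : Ω → V*` is weak* measurable: each `x ↦ ⟨v, f(x)⟩` is Lebesgue measurable on `Ω`. -/
def WeakStarMeasurable {n : ℕ} (Ω : Set (EuclideanSpace ℝ (Fin n)))
    (f : EuclideanSpace ℝ (Fin n) → StrongDual ℝ V) : Prop :=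
  ∀ v : V, AEMeasurable (fun x => f x v) (volume.restrict Ω)

/-- `f ∈ L^p_*(Ω; V*)` (for `p < ∞`). -/
def MemLpStar {n : ℕ} (Ω : Set (EuclideanSpace ℝ (Fin n))) (p : ℝ≥0∞)
    (f : EuclideanSpace ℝ (Fin n) → StrongDual ℝ V) : Prop :=
  WeakStarMeasurable Ω f ∧ upperIntegral Ω (fun x => ‖f x‖ ^ p.toReal) < ⊤

/-- `Λ ∈ V*` is the Gelfand integral of `F` over `Ω`:
`⟨v, Λ⟩ = ∫_Ω ⟨v, F(x)⟩ dx` for every `v ∈ V`. -/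
def IsGelfandIntegral {n : ℕ} (Ω : Set (EuclideanSpace ℝ (Fin n)))
    (F : EuclideanSpace ℝ (Fin n) → StrongDual ℝ V) (Λ : StrongDual ℝ V) : Prop :=
  ∀ v : V, IntegrableOn (fun x => F x v) Ω ∧ Λ v = ∫ x in Ω, F x v

/-- `f'` is a `j`-th partial weak weak* derivative of `f` on `Ω`: for every `φ ∈ C₀^∞(Ω)` one has
`∫_Ω ∂_jφ f = -∫_Ω φ f'` in the sense of Gelfand integrals. -/
def HasWeakWeakStarDeriv {n : ℕ} (Ω : Set (EuclideanSpace ℝ (Fin n))) (j : Fin n)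
    (f f' : EuclideanSpace ℝ (Fin n) → StrongDual ℝ V) : Prop :=
  ∀ φ : EuclideanSpace ℝ (Fin n) → ℝ, IsTestFunction Ω φ →
    ∃ Λ : StrongDual ℝ V,
      IsGelfandIntegral Ω (fun x => partialDeriv j φ x • f x) Λ ∧
      IsGelfandIntegral Ω (fun x => φ x • f' x) (-Λ)

variable (V) in
/-- The Sobolev space `W^{1,p}_*(Ω; V*)`. -/
def sobolevStar {n : ℕ} (Ω : Set (EuclideanSpace ℝ (Fin n))) (p : ℝ≥0∞) :
    Set (EuclideanSpace ℝ (Fin n) → StrongDual ℝ V) :=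
  {f | MemLpMetric Ω p f ∧
    ∀ j : Fin n, ∃ f' : EuclideanSpace ℝ (Fin n) → StrongDual ℝ V,
      MemLpStar Ω p f' ∧ HasWeakWeakStarDeriv Ω j f f'}

/-! ### Sobolev norms -/

/-- The norm `‖f‖_{W^{1,p}} = ‖f‖_{L^p} + inf_g ‖g‖_{L^p}`, the infimum being over all Reshetnyak
upper gradients `g` of `f`. -/
def normReshetnyak {n : ℕ} (Ω : Set (EuclideanSpace ℝ (Fin n))) (p : ℝ≥0∞)
    (f : EuclideanSpace ℝ (Fin n) → StrongDual ℝ V) : ℝ≥0∞ :=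
  eLpNorm f p (volume.restrict Ω) +
    ⨅ (g : EuclideanSpace ℝ (Fin n) → ℝ) (_ : IsReshetnyakUpperGradient Ω p f g),
      eLpNorm g p (volume.restrict Ω)

/-- The norm of `W^{1,p}_*`: `‖f‖_{L^p}` plus the infimum of the `p`-th roots of the upper
integrals of `|(f¹, …, fⁿ)|^p` over all tuples of weak weak* derivatives `f^j` of `f`, where `|·|`
is the `ℓ^q` product norm on `(V*)ⁿ` (Euclidean for `q = 2`, maximum for `q = ∞`). Tuples that are
not in `L^p_*` have infinite upper integral, so that leaving them out does not change the
infimum. -/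
def normStar {n : ℕ} (Ω : Set (EuclideanSpace ℝ (Fin n))) (p q : ℝ≥0∞)
    (f : EuclideanSpace ℝ (Fin n) → StrongDual ℝ V) : ℝ≥0∞ :=
  eLpNorm f p (volume.restrict Ω) +
    ⨅ (F : Fin n → EuclideanSpace ℝ (Fin n) → StrongDual ℝ V)
      (_ : ∀ j, MemLpStar Ω p (F j) ∧ HasWeakWeakStarDeriv Ω j f (F j)),
      (upperIntegral Ω (fun x => ‖WithLp.toLp q (fun j => F j x)‖ ^ p.toReal)) ^ (1 / p.toReal)

end Dual

end WeakStarSobolev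

end

section

open Filter Topology
open scoped Convolution

namespace WeakStarSobolev

variable {n : ℕ} {Ω : Set (EuclideanSpace ℝ (Fin n))}


/-! ### Mollification -/

/-! Both inclusions rest on mollification with `mollifier n k`. From weak weak* derivatives to upper
gradients: if `g` dominates `‖f'‖`, the mollified map is smooth and its `j`-th derivative is bounded
by the mollified `g`, because mollifiers are test functions. Composing with an `L`-Lipschitz `φ`,
integrating by parts and removing the mollification gives `|∫ ∂ⱼψ φ(f)| ≤ L ∫ |ψ| g`
(`abs_integral_partialDeriv_comp_le`). Such a bound yields a weak derivative dominated by `L g`: the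
distributional derivative is continuous in a weighted `L²` norm, so Riesz representation applies
(`exists_hasWeakPartialDeriv_of_test_bound`). Conversely, evaluation at `v` is `‖v‖`-Lipschitz on
`V*`, so an upper gradient `g` produces weak derivatives `w v` of all components, with `|w v| ≤ ‖v‖
g` a.e. The null set depends on `v` and `V` need not be separable. Mollified components are exactly
linear in `v` at every point; their limits along one fixed ultrafilter are functionals of norm at
most `g x` wherever the mollified `g` converges to `g x ≥ 0`
(`exists_hasWeakWeakStarDeriv_of_components`). The factors `√n` compare a product norm with the
largest component. Metric targets follow from McShane extension of Lipschitz functions, and the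
embedding of `X` is Kuratowski's followed by the inclusion into the bidual. -/

/-- A sequence of bump functions at the origin with supports shrinking to a point. -/
noncomputable def shrinkingBump (n k : ℕ) : ContDiffBump (0 : EuclideanSpace ℝ (Fin n)) where
  rIn := 1 / (2 * ((k : ℝ) + 1))
  rOut := 1 / ((k : ℝ) + 1)
  rIn_pos := by positivity
  rIn_lt_rOut := by
    apply one_div_lt_one_div_of_lt <;> nlinarith [Nat.cast_nonneg (α := ℝ) k]

/-- The standard mollifiers. -/
noncomputable def mollifier (n k : ℕ) : EuclideanSpace ℝ (Fin n) → ℝ :=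
  (shrinkingBump n k).normed volume

lemma tendsto_shrinkingBump_rOut (n : ℕ) :
    Tendsto (fun k => (shrinkingBump n k).rOut) atTop (𝓝 0) :=
  tendsto_one_div_add_atTop_nhds_zero_nat

lemma mollifier_nonneg (n k : ℕ) (x : EuclideanSpace ℝ (Fin n)) : 0 ≤ mollifier n k x :=
  (shrinkingBump n k).nonneg_normed x

lemma contDiff_mollifier (n k : ℕ) {m : ℕ∞} : ContDiff ℝ m (mollifier n k) :=
  (shrinkingBump n k).contDiff_normed

lemma hasCompactSupport_mollifier (n k : ℕ) : HasCompactSupport (mollifier n k) :=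
  (shrinkingBump n k).hasCompactSupport_normed

lemma tsupport_mollifier (n k : ℕ) :
    tsupport (mollifier n k) = Metric.closedBall 0 (shrinkingBump n k).rOut :=
  (shrinkingBump n k).tsupport_normed_eq

lemma mollifier_neg (n k : ℕ) (x : EuclideanSpace ℝ (Fin n)) :
    mollifier n k (-x) = mollifier n k x :=
  (shrinkingBump n k).normed_neg x

lemma mollifier_sub_comm (n k : ℕ) (x y : EuclideanSpace ℝ (Fin n)) :
    mollifier n k (x - y) = mollifier n k (y - x) := by
  rw [← mollifier_neg, neg_sub]

/-- This lets pointwise values of a mollification be read as pairings with test functions. -/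
lemma isTestFunction_mollifier_sub {k : ℕ} {x : EuclideanSpace ℝ (Fin n)}
    (hx : Metric.closedBall x (shrinkingBump n k).rOut ⊆ Ω) :
    IsTestFunction Ω (fun y => mollifier n k (x - y)) := by
  have hs : tsupport (fun y => mollifier n k (x - y)) ⊆
      Metric.closedBall x (shrinkingBump n k).rOut := by
    refine closure_minimal (fun y hy => ?_) Metric.isClosed_closedBall
    have : x - y ∈ tsupport (mollifier n k) := subset_tsupport _ hy
    rw [tsupport_mollifier, mem_closedBall_zero_iff] at this
    rwa [Metric.mem_closedBall, dist_comm, dist_eq_norm]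
  refine ⟨(contDiff_mollifier n k).comp (contDiff_const.sub contDiff_id), ?_, hs.trans hx⟩
  exact (isCompact_closedBall _ _).of_isClosed_subset (isClosed_tsupport _) hs

lemma partialDeriv_mollifier_sub (k : ℕ) (j : Fin n) (x y : EuclideanSpace ℝ (Fin n)) :
    partialDeriv j (fun y => mollifier n k (x - y)) y =
      -(fderiv ℝ (mollifier n k) (x - y) (EuclideanSpace.single j 1)) := by
  have h : HasFDerivAt (fun y => mollifier n k (x - y))
      ((fderiv ℝ (mollifier n k) (x - y)).comp
        (-(ContinuousLinearMap.id ℝ (EuclideanSpace ℝ (Fin n))))) y := by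
    have h1 : HasFDerivAt (mollifier n k) (fderiv ℝ (mollifier n k) (x - y)) (x - y) :=
      ((contDiff_mollifier n k (m := 1)).differentiable (by simp) _).hasFDerivAt
    exact h1.comp y ((hasFDerivAt_id y).const_sub x)
  simp [partialDeriv, h.fderiv]

lemma integrable_indicator_of_integrableOn {F : Type*} [NormedAddCommGroup F] (hΩ : IsOpen Ω)
    {a : EuclideanSpace ℝ (Fin n) → F} (ha : IntegrableOn a Ω) :
    Integrable (Ω.indicator a) :=
  ha.integrable_indicator hΩ.measurableSet

lemma mollifier_convolution_indicator {F : Type*} [NormedAddCommGroup F] [NormedSpace ℝ F]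
    (hΩ : IsOpen Ω) (a : EuclideanSpace ℝ (Fin n) → F) (k : ℕ) (x : EuclideanSpace ℝ (Fin n)) :
    (mollifier n k ⋆[ContinuousLinearMap.lsmul ℝ ℝ, volume] Ω.indicator a) x =
      ∫ y in Ω, mollifier n k (x - y) • a y := by
  rw [convolution_eq_swap, ← integral_indicator hΩ.measurableSet]
  congr 1 with y
  by_cases hy : y ∈ Ω <;> simp [hy]

lemma ae_tendsto_mollifier_convolution {F : Type*} [NormedAddCommGroup F] [NormedSpace ℝ F]
    [CompleteSpace F] {a : EuclideanSpace ℝ (Fin n) → F} (ha : LocallyIntegrable a) :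
    ∀ᵐ x, Tendsto (fun k => (mollifier n k ⋆[ContinuousLinearMap.lsmul ℝ ℝ, volume] a) x)
      atTop (𝓝 (a x)) := by
  -- The ratio of outer to inner radius stays equal to 2, as convergence at Lebesgue points
  -- requires.
  refine ContDiffBump.ae_convolution_tendsto_right_of_locallyIntegrable (K := 2)
    (tendsto_shrinkingBump_rOut n) (Eventually.of_forall fun k => ?_) ha
  simp only [shrinkingBump]
  apply le_of_eq
  field_simp

/-- Lebesgue differentiation for mollifications over an open set. -/
lemma ae_tendsto_setIntegral_mollifier {F : Type*} [NormedAddCommGroup F] [NormedSpace ℝ F]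
    [CompleteSpace F] (hΩ : IsOpen Ω) {a : EuclideanSpace ℝ (Fin n) → F}
    (ha : IntegrableOn a Ω) :
    ∀ᵐ x ∂(volume.restrict Ω), Tendsto (fun k => ∫ y in Ω, mollifier n k (x - y) • a y)
      atTop (𝓝 (a x)) := by
  rw [ae_restrict_iff' hΩ.measurableSet]
  filter_upwards [ae_tendsto_mollifier_convolution
    (integrable_indicator_of_integrableOn hΩ ha).locallyIntegrable] with x hx hxΩ
  simpa only [mollifier_convolution_indicator hΩ, Set.indicator_of_mem hxΩ] using hx

lemma eventually_closedBall_rOut_subset {K : Set (EuclideanSpace ℝ (Fin n))} (hK : IsCompact K)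
    (hΩ : IsOpen Ω) (hKΩ : K ⊆ Ω) :
    ∀ᶠ k in atTop, ∀ x ∈ K, Metric.closedBall x (shrinkingBump n k).rOut ⊆ Ω := by
  obtain ⟨δ, hδ, hδΩ⟩ := hK.exists_cthickening_subset_open hΩ hKΩ
  filter_upwards [(tendsto_shrinkingBump_rOut n).eventually_le_const hδ] with k hk x hx
  exact ((Metric.closedBall_subset_closedBall hk).trans
    (Metric.closedBall_subset_cthickening hx δ)).trans hδΩ

/-! ### Test functions -/

namespace IsTestFunction

variable {ψ : EuclideanSpace ℝ (Fin n) → ℝ}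

lemma continuous (h : IsTestFunction Ω ψ) : Continuous ψ := h.1.continuous

lemma exists_abs_le (h : IsTestFunction Ω ψ) : ∃ C, ∀ x, ‖ψ x‖ ≤ C :=
  h.2.1.exists_bound_of_continuous h.continuous

lemma continuous_partialDeriv (h : IsTestFunction Ω ψ) (j : Fin n) :
    Continuous (partialDeriv j ψ) :=
  (h.1.continuous_fderiv (by simp)).clm_apply continuous_const

lemma hasCompactSupport_partialDeriv (h : IsTestFunction Ω ψ) (j : Fin n) :
    HasCompactSupport (partialDeriv j ψ) :=
  h.2.1.fderiv_apply (𝕜 := ℝ) _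

lemma tsupport_partialDeriv_subset (h : IsTestFunction Ω ψ) (j : Fin n) :
    tsupport (partialDeriv j ψ) ⊆ Ω :=
  (tsupport_fderiv_apply_subset ℝ _).trans h.2.2

lemma exists_abs_partialDeriv_le (h : IsTestFunction Ω ψ) (j : Fin n) :
    ∃ C, ∀ x, ‖partialDeriv j ψ x‖ ≤ C :=
  (h.hasCompactSupport_partialDeriv j).exists_bound_of_continuous (h.continuous_partialDeriv j)

lemma integrableOn_smul {F : Type*} [NormedAddCommGroup F] [NormedSpace ℝ F]
    {a : EuclideanSpace ℝ (Fin n) → F} (h : IsTestFunction Ω ψ) (ha : IntegrableOn a Ω) :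
    IntegrableOn (fun x => ψ x • a x) Ω := by
  obtain ⟨C, hC⟩ := h.exists_abs_le
  exact ha.bdd_smul C h.continuous.aestronglyMeasurable (Eventually.of_forall hC)

lemma integrableOn_partialDeriv_smul {F : Type*} [NormedAddCommGroup F] [NormedSpace ℝ F]
    {a : EuclideanSpace ℝ (Fin n) → F} (h : IsTestFunction Ω ψ) (j : Fin n)
    (ha : IntegrableOn a Ω) :
    IntegrableOn (fun x => partialDeriv j ψ x • a x) Ω := by
  obtain ⟨C, hC⟩ := h.exists_abs_partialDeriv_le j
  exact ha.bdd_smul C (h.continuous_partialDeriv j).aestronglyMeasurable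
    (Eventually.of_forall hC)

end IsTestFunction

/-- A function controlled against nonnegative test functions is controlled almost everywhere. -/
lemma ae_abs_le_of_forall_test (hΩ : IsOpen Ω) {a b : EuclideanSpace ℝ (Fin n) → ℝ}
    (ha : IntegrableOn a Ω) (hb : IntegrableOn b Ω)
    (h : ∀ ψ, IsTestFunction Ω ψ → (∀ x, 0 ≤ ψ x) →
      |∫ x in Ω, ψ x * a x| ≤ ∫ x in Ω, ψ x * b x) :
    ∀ᵐ x ∂(volume.restrict Ω), |a x| ≤ b x := by
  filter_upwards [ae_tendsto_setIntegral_mollifier hΩ ha, ae_tendsto_setIntegral_mollifier hΩ hb,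
    ae_restrict_mem hΩ.measurableSet] with x hxa hxb hx
  -- Test with mollifiers centred at `x`, a point where the mollifications of both `a` and `b`
  -- converge.
  refine le_of_tendsto_of_tendsto hxa.abs hxb ?_
  filter_upwards [eventually_closedBall_rOut_subset isCompact_singleton hΩ
    (Set.singleton_subset_iff.2 hx)] with k hk
  exact h _ (isTestFunction_mollifier_sub (hk x rfl)) fun y => mollifier_nonneg n k _

/-! ### Weak derivatives from test bounds, by `L²` duality -/

/-- The vector space of test functions. -/
def testSpace (Ω : Set (EuclideanSpace ℝ (Fin n))) : Submodule ℝ (EuclideanSpace ℝ (Fin n) → ℝ) where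
  carrier := {ψ | IsTestFunction Ω ψ}
  add_mem' := fun {a b} ha hb => ⟨ha.1.add hb.1, ha.2.1.add hb.2.1,
    (tsupport_add a b).trans (Set.union_subset ha.2.2 hb.2.2)⟩
  zero_mem' := ⟨contDiff_const, HasCompactSupport.zero, by simp [tsupport]⟩
  smul_mem' := fun c ψ h => ⟨contDiff_const.smul h.1, h.2.1.smul_left (f := fun _ => c),
    (tsupport_smul_subset_right (fun _ => c) ψ).trans h.2.2⟩

lemma partialDeriv_add {ψ χ : EuclideanSpace ℝ (Fin n) → ℝ} (hψ : IsTestFunction Ω ψ)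
    (hχ : IsTestFunction Ω χ) (j : Fin n) (x : EuclideanSpace ℝ (Fin n)) :
    partialDeriv j (ψ + χ) x = partialDeriv j ψ x + partialDeriv j χ x := by
  rw [partialDeriv, fderiv_add (hψ.1.differentiable (by simp) x)
    (hχ.1.differentiable (by simp) x)]
  rfl

lemma partialDeriv_smul {ψ : EuclideanSpace ℝ (Fin n) → ℝ} (hψ : IsTestFunction Ω ψ) (c : ℝ)
    (j : Fin n) (x : EuclideanSpace ℝ (Fin n)) :
    partialDeriv j (c • ψ) x = c * partialDeriv j ψ x := by
  rw [partialDeriv, fderiv_const_smul (hψ.1.differentiable (by simp) x)]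
  rfl

/-- A linear functional dominated by the norm of a linear map into a normed space factors through
a continuous functional on that space. -/
lemma exists_strongDual_comp_eq {S H : Type*} [AddCommGroup S] [Module ℝ S]
    [NormedAddCommGroup H] [NormedSpace ℝ H] (A : S →ₗ[ℝ] H) (T : S →ₗ[ℝ] ℝ) (C : ℝ)
    (h : ∀ s, |T s| ≤ C * ‖A s‖) : ∃ Λ : StrongDual ℝ H, ∀ s, Λ (A s) = T s := by
  have hker : LinearMap.ker A ≤ LinearMap.ker T := by
    intro s hs
    have := h s
    rw [LinearMap.mem_ker.1 hs, norm_zero, mul_zero] at this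
    exact LinearMap.mem_ker.2 (abs_nonpos_iff.1 this)
  -- The bound makes `T` vanish on the kernel of `A`, so it descends to the range; Hahn–Banach then
  -- extends it to `H`.
  let T' : LinearMap.range A →ₗ[ℝ] ℝ :=
    ((LinearMap.ker A).liftQ T hker).comp A.quotKerEquivRange.symm.toLinearMap
  have hT' : ∀ s, T' ⟨A s, LinearMap.mem_range_self A s⟩ = T s := by
    intro s
    have : A.quotKerEquivRange.symm ⟨A s, LinearMap.mem_range_self A s⟩ =
        Submodule.Quotient.mk s := by
      rw [LinearEquiv.symm_apply_eq]
      rfl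
    simp only [T', LinearMap.comp_apply, LinearEquiv.coe_coe]
    rw [this]
    rfl
  have hbound : ∀ y : LinearMap.range A, ‖T' y‖ ≤ C * ‖y‖ := by
    rintro ⟨_, s, rfl⟩
    rw [hT']
    exact h s
  obtain ⟨Λ, hΛ, -⟩ := exists_extension_norm_eq (LinearMap.range A) (T'.mkContinuous C hbound)
  exact ⟨Λ, fun s => (hΛ ⟨A s, LinearMap.mem_range_self A s⟩).trans (hT' s)⟩

lemma inner_toLp_toLp {α : Type*} [MeasurableSpace α] {μ : Measure α} {a b : α → ℝ}
    (ha : MemLp a 2 μ) (hb : MemLp b 2 μ) :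
    inner ℝ (ha.toLp a) (hb.toLp b) = ∫ x, b x * a x ∂μ := by
  rw [L2.inner_def]
  refine integral_congr_ae ?_
  filter_upwards [ha.coeFn_toLp, hb.coeFn_toLp] with x h1 h2
  rw [h1, h2]
  rfl

/-- The square is `ψ² g`, so an `L¹` weight and a bounded `ψ` suffice. -/
lemma memLp_two_sqrt_mul {g ψ : EuclideanSpace ℝ (Fin n) → ℝ}
    (hg : IntegrableOn g Ω) (hg0 : ∀ᵐ x ∂(volume.restrict Ω), 0 ≤ g x)
    (hψ : Continuous ψ) {C : ℝ} (hC : ∀ x, ‖ψ x‖ ≤ C) :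
    MemLp (fun x => √(g x) * ψ x) 2 (volume.restrict Ω) := by
  have hm : AEStronglyMeasurable (fun x => √(g x)) (volume.restrict Ω) :=
    Real.continuous_sqrt.comp_aestronglyMeasurable hg.aestronglyMeasurable
  refine (memLp_two_iff_integrable_sq (hm.mul hψ.aestronglyMeasurable)).2 ?_
  have h1 : Integrable (fun x => (ψ x ^ 2) * g x) (volume.restrict Ω) := by
    refine hg.bdd_mul (c := C ^ 2) (hψ.pow 2).aestronglyMeasurable (Eventually.of_forall fun x => ?_)
    rw [norm_pow]
    gcongr
    exact hC x
  refine h1.congr ?_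
  filter_upwards [hg0] with x hx
  rw [Pi.mul_apply, mul_pow, Real.sq_sqrt hx, mul_comm]

/-- An `L¹`-type bound of the distributional derivative against test functions produces a weak
derivative with the corresponding pointwise bound. -/
theorem exists_hasWeakPartialDeriv_of_test_bound (hΩ : IsOpen Ω) (j : Fin n)
    {u g : EuclideanSpace ℝ (Fin n) → ℝ} (hu : IntegrableOn u Ω) (hg : IntegrableOn g Ω)
    (hg0 : ∀ᵐ x ∂(volume.restrict Ω), 0 ≤ g x) {L : ℝ} (hL : 0 ≤ L)
    (h : ∀ ψ, IsTestFunction Ω ψ →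
      |∫ x in Ω, partialDeriv j ψ x * u x| ≤ L * ∫ x in Ω, |ψ x| * g x) :
    ∃ u' : EuclideanSpace ℝ (Fin n) → ℝ, IntegrableOn u' Ω ∧ HasWeakPartialDeriv Ω j u u' ∧
      ∀ᵐ x ∂(volume.restrict Ω), |u' x| ≤ L * g x := by
  have hmem : ∀ ψ, IsTestFunction Ω ψ →
      MemLp (fun x => √(g x) * ψ x) 2 (volume.restrict Ω) := fun ψ hψ => by
    obtain ⟨C, hC⟩ := hψ.exists_abs_le
    exact memLp_two_sqrt_mul hg hg0 hψ.continuous hC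
  have hsqrt : MemLp (fun x => √(g x)) 2 (volume.restrict Ω) := by
    simpa using memLp_two_sqrt_mul hg hg0 (continuous_const (y := (1 : ℝ)))
      (C := 1) (by simp)
  let A : testSpace Ω →ₗ[ℝ] Lp ℝ 2 (volume.restrict Ω) :=
    { toFun := fun ψ => (hmem ψ.1 ψ.2).toLp _
      map_add' := fun ψ χ => by
        rw [← MemLp.toLp_add]
        congr 1 with x
        simp [mul_add]
      map_smul' := fun c ψ => by
        rw [RingHom.id_apply, ← MemLp.toLp_const_smul]
        congr 1 with x
        simp [mul_left_comm] }
  let T : testSpace Ω →ₗ[ℝ] ℝ :=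
    { toFun := fun ψ => -∫ x in Ω, partialDeriv j ψ.1 x * u x
      map_add' := fun ψ χ => by
        have := integral_add (ψ.2.integrableOn_partialDeriv_smul j hu)
          (χ.2.integrableOn_partialDeriv_smul j hu)
        simp only [smul_eq_mul] at this
        rw [← neg_add, ← this]
        congr 2 with x
        rw [Submodule.coe_add, partialDeriv_add ψ.2 χ.2]
        simp [add_mul]
      map_smul' := fun c ψ => by
        rw [RingHom.id_apply, smul_eq_mul, mul_neg, ← integral_const_mul]
        congr 2 with x
        rw [Submodule.coe_smul, partialDeriv_smul ψ.2, mul_assoc] }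
  -- Cauchy–Schwarz for the splitting `|ψ| g = √g · (√g |ψ|)`.
  have hTA : ∀ ψ, |T ψ| ≤ (L * ‖hsqrt.toLp _‖) * ‖A ψ‖ := by
    intro ψ
    have hm' := (hmem ψ.1 ψ.2).norm
    have h1 : ∫ x in Ω, |ψ.1 x| * g x = inner ℝ (hsqrt.toLp _) (hm'.toLp _) := by
      rw [inner_toLp_toLp]
      refine integral_congr_ae ?_
      filter_upwards [hg0] with x hx
      rw [norm_mul, Real.norm_of_nonneg (Real.sqrt_nonneg _), Real.norm_eq_abs, mul_right_comm,
        Real.mul_self_sqrt hx, mul_comm]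
    have h2 : ‖hm'.toLp _‖ = ‖A ψ‖ := by
      simp only [A, LinearMap.coe_mk, AddHom.coe_mk]
      rw [Lp.norm_toLp, Lp.norm_toLp, eLpNorm_norm]
    calc |T ψ| ≤ L * ∫ x in Ω, |ψ.1 x| * g x := by
          simp only [T, LinearMap.coe_mk, AddHom.coe_mk, abs_neg]
          exact h ψ.1 ψ.2
      _ ≤ L * (‖hsqrt.toLp _‖ * ‖hm'.toLp _‖) := by
          rw [h1]
          gcongr
          exact real_inner_le_norm _ _
      _ = _ := by rw [h2, mul_assoc]
  obtain ⟨Λ, hΛ⟩ := exists_strongDual_comp_eq A T _ hTA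
  -- The Riesz representative `w` gives the weak derivative `√g w`, integrable as a product of two
  -- `L²` functions.
  let w : Lp ℝ 2 (volume.restrict Ω) := (InnerProductSpace.toDual ℝ _).symm Λ
  have hw : ∀ ψ : testSpace Ω, ∫ x in Ω, ψ.1 x * (√(g x) * w x) = T ψ := by
    intro ψ
    rw [← hΛ, ← InnerProductSpace.toDual_symm_apply (𝕜 := ℝ) (y := Λ)]
    change _ = inner ℝ w (A ψ)
    rw [← Lp.toLp_coeFn w (Lp.memLp w)]
    simp only [A, LinearMap.coe_mk, AddHom.coe_mk]
    rw [inner_toLp_toLp]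
    refine integral_congr_ae (Eventually.of_forall fun x => ?_)
    simp only [Lp.toLp_coeFn]
    ring
  have hint : IntegrableOn (fun x => √(g x) * w x) Ω := hsqrt.integrable_mul (Lp.memLp w)
  refine ⟨fun x => √(g x) * w x, hint, ⟨hu.locallyIntegrableOn, hint.locallyIntegrableOn,
    fun ψ hψ => ?_⟩, ?_⟩
  · rw [hw ⟨ψ, hψ⟩]
    simp [T]
  -- Riesz only gives an `L²` bound on `w`; the pointwise bound comes from using the hypothesis
  -- again on nonnegative test functions.
  · refine ae_abs_le_of_forall_test hΩ hint (hg.const_mul L) fun ψ hψ hψ0 => ?_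
    rw [hw ⟨ψ, hψ⟩]
    simp only [T, LinearMap.coe_mk, AddHom.coe_mk, abs_neg]
    refine (h ψ hψ).trans (le_of_eq ?_)
    rw [← integral_const_mul]
    congr 1 with x
    rw [abs_of_nonneg (hψ0 x), mul_left_comm]


/-! ### Lipschitz functions of mollified maps -/

/-- Difference quotients of `φ ∘ f` are at most `L` times those of `f`, so `φ` itself need not be
differentiable. Where the line derivative does not exist its default value is zero. -/
lemma abs_lineDeriv_comp_le {E F : Type*} [NormedAddCommGroup E] [NormedSpace ℝ E]
    [NormedAddCommGroup F] [NormedSpace ℝ F] {f : E → F} {f' : E →L[ℝ] F} {x e : E}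
    (hf : HasFDerivAt f f' x) {L : ℝ≥0} {φ : F → ℝ} (hφ : LipschitzWith L φ) :
    |lineDeriv ℝ (φ ∘ f) x e| ≤ L * ‖f' e‖ := by
  by_cases h : LineDifferentiableAt ℝ (φ ∘ f) x e
  · have h1 := (hasDerivAt_iff_tendsto_slope.1 h.hasLineDerivAt).norm
    have h2 := ((hasDerivAt_iff_tendsto_slope.1 (hf.hasLineDerivAt e)).norm).const_mul (L : ℝ)
    refine le_of_tendsto_of_tendsto h1 h2 (Eventually.of_forall fun t => ?_)
    simp only [slope_def_module, norm_smul, Function.comp_apply]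
    rw [mul_left_comm]
    gcongr
    exact hφ.norm_sub_le _ _
  · rw [lineDeriv_zero_of_not_lineDifferentiableAt h, abs_zero]
    positivity

lemma setIntegral_mul_eq_integral {ψ a : EuclideanSpace ℝ (Fin n) → ℝ} (hψ : tsupport ψ ⊆ Ω) :
    ∫ x in Ω, ψ x * a x = ∫ x, ψ x * a x := by
  refine setIntegral_eq_integral_of_forall_compl_eq_zero fun x hx => ?_
  rw [image_eq_zero_of_notMem_tsupport fun h => hx (hψ h), zero_mul]

lemma integral_mollifier (n k : ℕ) : ∫ x, mollifier n k x = 1 :=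
  (shrinkingBump n k).integral_normed

lemma integrable_mollifier (n k : ℕ) : Integrable (mollifier n k) :=
  (contDiff_mollifier n k (m := 0)).continuous.integrable_of_hasCompactSupport
    (hasCompactSupport_mollifier n k)

/-- Mollification is symmetric with respect to the `L²` pairing. -/
lemma integral_mul_mollifier_convolution {g χ : EuclideanSpace ℝ (Fin n) → ℝ} (hg : Integrable g)
    (hχ : Continuous χ) {C : ℝ} (hC : ∀ x, ‖χ x‖ ≤ C) (k : ℕ) :
    ∫ x, χ x * (mollifier n k ⋆[ContinuousLinearMap.lsmul ℝ ℝ, volume] g) x =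
      ∫ y, (mollifier n k ⋆[ContinuousLinearMap.lsmul ℝ ℝ, volume] χ) y * g y := by
  have h1 : Integrable (fun q : EuclideanSpace ℝ (Fin n) × EuclideanSpace ℝ (Fin n) =>
      g q.2 * mollifier n k (q.1 - q.2)) (volume.prod volume) :=
    hg.convolution_integrand (ContinuousLinearMap.mul ℝ ℝ) (integrable_mollifier n k)
  have h2 : Integrable (fun q : EuclideanSpace ℝ (Fin n) × EuclideanSpace ℝ (Fin n) =>
      χ q.1 * (g q.2 * mollifier n k (q.1 - q.2))) (volume.prod volume) :=
    h1.bdd_mul (c := C) (hχ.comp continuous_fst).aestronglyMeasurable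
      (Eventually.of_forall fun q => hC q.1)
  calc ∫ x, χ x * (mollifier n k ⋆[ContinuousLinearMap.lsmul ℝ ℝ, volume] g) x
      = ∫ x, ∫ y, χ x * (g y * mollifier n k (x - y)) := by
        congr 1 with x
        rw [convolution_eq_swap, ← integral_const_mul]
        congr 1 with y
        simp [mul_comm]
    _ = ∫ y, ∫ x, χ x * (g y * mollifier n k (x - y)) := integral_integral_swap h2
    _ = _ := by
        congr 1 with y
        rw [convolution_eq_swap, ← integral_mul_const]
        congr 1 with x
        -- After Fubini, evenness of the mollifier turns the inner integral into a convolution with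
        -- `χ`.
        rw [mollifier_sub_comm]
        simp only [ContinuousLinearMap.lsmul_apply, smul_eq_mul]
        ring

lemma norm_mollifier_convolution_le {χ : EuclideanSpace ℝ (Fin n) → ℝ} {C : ℝ}
    (hC : ∀ x, ‖χ x‖ ≤ C) (k : ℕ) (y : EuclideanSpace ℝ (Fin n)) :
    ‖(mollifier n k ⋆[ContinuousLinearMap.lsmul ℝ ℝ, volume] χ) y‖ ≤ C := by
  have h := norm_integral_le_of_norm_le ((integrable_mollifier n k).mul_const C)
    (f := fun t => mollifier n k t • χ (y - t)) (Eventually.of_forall fun t => by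
      rw [norm_smul, Real.norm_of_nonneg (mollifier_nonneg n k t)]
      exact mul_le_mul_of_nonneg_left (hC _) (mollifier_nonneg n k t))
  rwa [integral_mul_const, integral_mollifier, one_mul] at h

/-- Moved onto the bounded continuous `χ`, the mollification converges everywhere under the uniform
bound `C`, so `C ‖g‖` is a dominating function. -/
lemma tendsto_integral_mul_mollifier_convolution {g χ : EuclideanSpace ℝ (Fin n) → ℝ}
    (hg : Integrable g) (hχ : Continuous χ) {C : ℝ} (hC : ∀ x, ‖χ x‖ ≤ C) :
    Tendsto (fun k => ∫ x, χ x *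
      (mollifier n k ⋆[ContinuousLinearMap.lsmul ℝ ℝ, volume] g) x) atTop
      (𝓝 (∫ x, χ x * g x)) := by
  simp_rw [integral_mul_mollifier_convolution hg hχ hC]
  refine tendsto_integral_of_dominated_convergence (fun x => C * ‖g x‖) (fun k => ?_)
    (hg.norm.const_mul C) (fun k => Eventually.of_forall fun x => ?_)
    (Eventually.of_forall fun x => ?_)
  · refine (Continuous.aestronglyMeasurable ?_).mul hg.aestronglyMeasurable
    exact ((hasCompactSupport_mollifier n k).contDiff_convolution_left (n := 0) _
      (contDiff_mollifier n k) hχ.locallyIntegrable).continuous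
  · rw [norm_mul]
    gcongr
    exact norm_mollifier_convolution_le hC k x
  · exact (ContDiffBump.convolution_tendsto_right_of_continuous (tendsto_shrinkingBump_rOut n) hχ
      x).mul_const _

lemma hasCompactSupport_indicator {F : Type*} [NormedAddCommGroup F]
    (hbdd : Bornology.IsBounded Ω) (a : EuclideanSpace ℝ (Fin n) → F) :
    HasCompactSupport (Ω.indicator a) :=
  HasCompactSupport.intro hbdd.isCompact_closure fun _ hx =>
    Set.indicator_of_notMem (fun h => hx (subset_closure h)) a

section Dual

variable {V : Type*} [NormedAddCommGroup V] [NormedSpace ℝ V]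
  {f f' : EuclideanSpace ℝ (Fin n) → StrongDual ℝ V} {g : EuclideanSpace ℝ (Fin n) → ℝ} {j : Fin n}

/-- A mollification of a map with a weak weak* derivative bounded by `g` has a derivative bounded
by the mollification of `g`. -/
lemma norm_fderiv_mollifier_convolution_le (hΩ : IsOpen Ω) (hf : IntegrableOn f Ω)
    (hf' : HasWeakWeakStarDeriv Ω j f f') (hg : IntegrableOn g Ω)
    (hfg : ∀ x ∈ Ω, ‖f' x‖ ≤ g x) {k : ℕ} {x : EuclideanSpace ℝ (Fin n)}
    (hx : Metric.closedBall x (shrinkingBump n k).rOut ⊆ Ω) :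
    ‖fderiv ℝ (mollifier n k ⋆[ContinuousLinearMap.lsmul ℝ ℝ, volume] Ω.indicator f) x
      (EuclideanSpace.single j 1)‖ ≤
      (mollifier n k ⋆[ContinuousLinearMap.lsmul ℝ ℝ, volume] Ω.indicator g) x := by
  set e : EuclideanSpace ℝ (Fin n) := EuclideanSpace.single j 1
  have htest := isTestFunction_mollifier_sub hx
  have hfi := integrable_indicator_of_integrableOn hΩ hf
  have hD := (hasCompactSupport_mollifier n k).hasFDerivAt_convolution_left
    (ContinuousLinearMap.lsmul ℝ ℝ) (contDiff_mollifier n k) hfi.locallyIntegrable x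
  have hexists := HasCompactSupport.convolutionExists_left (𝕜 := ℝ)
    (F := EuclideanSpace ℝ (Fin n) →L[ℝ] StrongDual ℝ V)
    ((ContinuousLinearMap.lsmul ℝ ℝ).precompL (EuclideanSpace ℝ (Fin n)))
    ((hasCompactSupport_mollifier n k).fderiv (𝕜 := ℝ))
    ((contDiff_mollifier n k (m := 1)).continuous_fderiv (by simp)) hfi.locallyIntegrable x
  -- The derivative falls on the mollifier; the sign comes from differentiating `x - y` in `y`
  -- rather than in `x`.
  have hval : fderiv ℝ (mollifier n k ⋆[ContinuousLinearMap.lsmul ℝ ℝ, volume] Ω.indicator f) x e =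
      -∫ y in Ω, partialDeriv j (fun y => mollifier n k (x - y)) y • f y := by
    rw [hD.fderiv, convolution_eq_swap,
      ContinuousLinearMap.integral_apply hexists.integrable_swap, ← integral_neg,
      ← integral_indicator hΩ.measurableSet]
    congr 1 with y : 1
    simp only [partialDeriv_mollifier_sub]
    by_cases hy : y ∈ Ω
    · rw [Set.indicator_of_mem hy, Set.indicator_of_mem hy]
      ext v
      simp [ContinuousLinearMap.precompL_apply, e]
    · simp [hy]
  obtain ⟨Λ, hΛ, hΛ'⟩ := hf' _ htest
  have hg' := htest.integrableOn_smul hg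
  have hg0 : 0 ≤ ∫ y in Ω, mollifier n k (x - y) • g y :=
    setIntegral_nonneg hΩ.measurableSet fun y hy =>
      smul_nonneg (mollifier_nonneg n k _) ((norm_nonneg _).trans (hfg y hy))
  rw [hval, mollifier_convolution_indicator hΩ]
  -- The Gelfand identity holds vector by vector, so the norm in `V*` is estimated by evaluating at
  -- each `v`.
  refine ContinuousLinearMap.opNorm_le_bound _ hg0 fun v => ?_
  have h1 : (-∫ y in Ω, partialDeriv j (fun y => mollifier n k (x - y)) y • f y) v =
      ∫ y in Ω, mollifier n k (x - y) * f' y v := by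
    rw [neg_apply,
      ContinuousLinearMap.integral_apply (htest.integrableOn_partialDeriv_smul j hf)]
    have := (hΛ v).2
    have h2 := (hΛ' v).2
    rw [neg_apply] at h2
    rw [← this, h2]
    rfl
  rw [h1, ← integral_mul_const]
  refine norm_integral_le_of_norm_le (hg'.mul_const _) ?_
  filter_upwards [ae_restrict_mem hΩ.measurableSet] with y hy
  rw [norm_mul, Real.norm_of_nonneg (mollifier_nonneg n k _), smul_eq_mul, mul_assoc]
  gcongr
  · exact mollifier_nonneg n k _
  · exact (f' y).le_of_opNorm_le (hfg y hy) v

/-- The distributional derivative bound for bounded Lipschitz functions of a mollified map. -/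
lemma abs_integral_partialDeriv_comp_mollifier_le (hΩ : IsOpen Ω) (hbdd : Bornology.IsBounded Ω)
    (hf : IntegrableOn f Ω) (hf' : HasWeakWeakStarDeriv Ω j f f') (hg : IntegrableOn g Ω)
    (hfg : ∀ x ∈ Ω, ‖f' x‖ ≤ g x) {L : ℝ≥0} {φ : StrongDual ℝ V → ℝ} (hφ : LipschitzWith L φ)
    {ψ : EuclideanSpace ℝ (Fin n) → ℝ} (hψ : IsTestFunction Ω ψ) {k : ℕ}
    (hk : ∀ x ∈ tsupport ψ, Metric.closedBall x (shrinkingBump n k).rOut ⊆ Ω) :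
    |∫ x, partialDeriv j ψ x *
      φ ((mollifier n k ⋆[ContinuousLinearMap.lsmul ℝ ℝ, volume] Ω.indicator f) x)| ≤
      L * ∫ x, |ψ x| *
        (mollifier n k ⋆[ContinuousLinearMap.lsmul ℝ ℝ, volume] Ω.indicator g) x := by
  set F := mollifier n k ⋆[ContinuousLinearMap.lsmul ℝ ℝ, volume] Ω.indicator f with hF
  set G := mollifier n k ⋆[ContinuousLinearMap.lsmul ℝ ℝ, volume] Ω.indicator g with hG
  set e : EuclideanSpace ℝ (Fin n) := EuclideanSpace.single j 1 with he
  have hFc : ContDiff ℝ 1 F := (hasCompactSupport_mollifier n k).contDiff_convolution_left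
    (n := 1) _ (contDiff_mollifier n k)
    (integrable_indicator_of_integrableOn hΩ hf).locallyIntegrable
  have hGc : Continuous G := ((hasCompactSupport_mollifier n k).contDiff_convolution_left
    (n := 0) _ (contDiff_mollifier n k)
    (integrable_indicator_of_integrableOn hΩ hg).locallyIntegrable).continuous
  -- Boundedness of `Ω` gives compact support, so the `C¹` map `F` is globally Lipschitz. Then `φ ∘
  -- F` is Lipschitz too and can be integrated by parts through its line derivative.
  have hFs : HasCompactSupport F := (hasCompactSupport_mollifier n k).convolution _
    (hasCompactSupport_indicator hbdd f)
  obtain ⟨C, hC⟩ := hFc.lipschitzWith_of_hasCompactSupport hFs (by simp)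
  obtain ⟨D, hD⟩ := hψ.1.lipschitzWith_of_hasCompactSupport hψ.2.1 (by simp)
  have hparts := (hφ.comp hC).integral_lineDeriv_mul_eq (μ := volume) hD hψ.2.1 e
  have h1 : ∫ x, partialDeriv j ψ x * φ (F x) = -∫ x, lineDeriv ℝ (φ ∘ F) x e * ψ x := by
    rw [hparts, ← integral_neg]
    congr 1 with x
    rw [lineDeriv_neg, (hψ.1.differentiable (by simp) x).lineDeriv_eq_fderiv, neg_mul, neg_neg]
    rfl
  rw [h1, abs_neg, ← integral_const_mul, ← Real.norm_eq_abs]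
  refine norm_integral_le_of_norm_le ?_ (Eventually.of_forall fun x => ?_)
  · refine Continuous.integrable_of_hasCompactSupport
      (continuous_const.mul (hψ.continuous.abs.mul hGc)) ?_
    exact (HasCompactSupport.mul_right (f := fun x => |ψ x|) hψ.2.1.norm).mul_left
  · by_cases hx : x ∈ tsupport ψ
    · rw [norm_mul, mul_comm |ψ x|, ← mul_assoc]
      refine mul_le_mul_of_nonneg_right ?_ (abs_nonneg (ψ x))
      exact (abs_lineDeriv_comp_le (hFc.differentiable (by simp) x).hasFDerivAt hφ).trans
        (mul_le_mul_of_nonneg_left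
          (norm_fderiv_mollifier_convolution_le hΩ hf hf' hg hfg (hk x hx)) L.2)
    · simp [image_eq_zero_of_notMem_tsupport hx]

/-- Passage to the limit in the mollified estimate. The bound `M` on `φ` supplies the dominating
function on the left; on the right the mollifier is moved onto `|ψ|`. -/
lemma abs_integral_partialDeriv_bdd_comp_le (hΩ : IsOpen Ω) (hbdd : Bornology.IsBounded Ω)
    (hf : IntegrableOn f Ω) (hf' : HasWeakWeakStarDeriv Ω j f f') (hg : IntegrableOn g Ω)
    (hfg : ∀ x ∈ Ω, ‖f' x‖ ≤ g x) {L : ℝ≥0} {φ : StrongDual ℝ V → ℝ} (hφ : LipschitzWith L φ)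
    {M : ℝ} (hM : ∀ z, ‖φ z‖ ≤ M)
    {ψ : EuclideanSpace ℝ (Fin n) → ℝ} (hψ : IsTestFunction Ω ψ) :
    |∫ x in Ω, partialDeriv j ψ x * φ (f x)| ≤ L * ∫ x in Ω, |ψ x| * g x := by
  have hfi := integrable_indicator_of_integrableOn hΩ hf
  have hgi := integrable_indicator_of_integrableOn hΩ hg
  obtain ⟨C, hC⟩ := hψ.exists_abs_le
  have hlim1 := tendsto_integral_mul_mollifier_convolution hgi hψ.continuous.abs (C := C)
    (fun x => by simpa using hC x)
  have hlim2 : Tendsto (fun k => ∫ x, partialDeriv j ψ x *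
      φ ((mollifier n k ⋆[ContinuousLinearMap.lsmul ℝ ℝ, volume] Ω.indicator f) x)) atTop
      (𝓝 (∫ x, partialDeriv j ψ x * φ (Ω.indicator f x))) := by
    have hdc := hψ.continuous_partialDeriv j
    refine tendsto_integral_of_dominated_convergence (fun x => ‖partialDeriv j ψ x‖ * M)
      (fun k => ?_) ?_ (fun k => Eventually.of_forall fun x => ?_) ?_
    · refine (hdc.mul (hφ.continuous.comp ?_)).aestronglyMeasurable
      exact ((hasCompactSupport_mollifier n k).contDiff_convolution_left (n := 0) _
        (contDiff_mollifier n k) hfi.locallyIntegrable).continuous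
    · exact ((hdc.integrable_of_hasCompactSupport
        (hψ.hasCompactSupport_partialDeriv j)).norm).mul_const M
    · rw [norm_mul]
      gcongr
      exact hM _
    · filter_upwards [ae_tendsto_mollifier_convolution hfi.locallyIntegrable] with x hx
      exact ((hφ.continuous.tendsto _).comp hx).const_mul _
  have hle := le_of_tendsto_of_tendsto hlim2.abs (hlim1.const_mul (L : ℝ)) (by
    filter_upwards [eventually_closedBall_rOut_subset hψ.2.1 hΩ hψ.2.2] with k hk
    exact abs_integral_partialDeriv_comp_mollifier_le hΩ hbdd hf hf' hg hfg hφ hψ hk)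
  rw [← setIntegral_mul_eq_integral (hψ.tsupport_partialDeriv_subset j),
    ← setIntegral_mul_eq_integral (ψ := fun x => |ψ x|)
      ((tsupport_comp_subset abs_zero ψ).trans hψ.2.2)] at hle
  have e1 : ∫ x in Ω, partialDeriv j ψ x * φ (Ω.indicator f x) =
      ∫ x in Ω, partialDeriv j ψ x * φ (f x) :=
    setIntegral_congr_fun hΩ.measurableSet fun x hx => by simp only [Set.indicator_of_mem hx]
  have e2 : ∫ x in Ω, |ψ x| * Ω.indicator g x = ∫ x in Ω, |ψ x| * g x :=
    setIntegral_congr_fun hΩ.measurableSet fun x hx => by simp only [Set.indicator_of_mem hx]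
  rwa [e1, e2] at hle

/-- Lipschitz functions of a map with a weak weak* derivative bounded by `g` have distributional
derivatives bounded by `g`, up to the Lipschitz constant. -/
theorem abs_integral_partialDeriv_comp_le (hΩ : IsOpen Ω) (hbdd : Bornology.IsBounded Ω)
    (hf : IntegrableOn f Ω) (hf' : HasWeakWeakStarDeriv Ω j f f') (hg : IntegrableOn g Ω)
    (hfg : ∀ x ∈ Ω, ‖f' x‖ ≤ g x) {L : ℝ≥0} {φ : StrongDual ℝ V → ℝ} (hφ : LipschitzWith L φ)
    (hφf : IntegrableOn (φ ∘ f) Ω)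
    {ψ : EuclideanSpace ℝ (Fin n) → ℝ} (hψ : IsTestFunction Ω ψ) :
    |∫ x in Ω, partialDeriv j ψ x * φ (f x)| ≤ L * ∫ x in Ω, |ψ x| * g x := by
  -- Truncating `φ` at height `M` keeps the Lipschitz constant. At each point the truncations are
  -- eventually constant, and `|φ ∘ f|` dominates them.
  have hlim : Tendsto (fun M : ℕ => ∫ x in Ω, partialDeriv j ψ x *
      max (min (φ (f x)) M) (-M : ℝ)) atTop (𝓝 (∫ x in Ω, partialDeriv j ψ x * φ (f x))) := by
    refine tendsto_integral_of_dominated_convergence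
      (fun x => ‖partialDeriv j ψ x • (φ ∘ f) x‖) (fun M => ?_)
      (hψ.integrableOn_partialDeriv_smul j hφf).norm
      (fun M => Eventually.of_forall fun x => ?_) (Eventually.of_forall fun x => ?_)
    · refine (hψ.continuous_partialDeriv j).aestronglyMeasurable.mul ?_
      exact (continuous_id.min continuous_const |>.max
        continuous_const).comp_aestronglyMeasurable hφf.aestronglyMeasurable
    · rw [norm_mul, norm_smul]
      gcongr
      have hM : (0 : ℝ) ≤ M := M.cast_nonneg
      simp only [Function.comp_apply, Real.norm_eq_abs]
      rcases le_total 0 (φ (f x)) with h | h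
      · rw [max_eq_left (by linarith [le_min h hM]), abs_of_nonneg (le_min h hM), abs_of_nonneg h]
        exact min_le_left _ _
      · rw [min_eq_left (h.trans hM), abs_of_nonpos (max_le h (by linarith)), abs_of_nonpos h]
        linarith [le_max_left (φ (f x)) (-M : ℝ)]
    · refine tendsto_const_nhds.congr' ?_
      filter_upwards [eventually_ge_atTop ⌈|φ (f x)|⌉₊] with M hM
      have hM' := abs_le.1 (Nat.ceil_le.1 hM)
      rw [min_eq_left hM'.2, max_eq_left hM'.1]
  refine le_of_tendsto hlim.abs (Eventually.of_forall fun M => ?_)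
  refine abs_integral_partialDeriv_bdd_comp_le hΩ hbdd hf hf' hg hfg
    (φ := fun z => max (min (φ z) M) (-M : ℝ)) ((hφ.min_const _).max_const _) (M := M)
    (fun z => abs_le.2 ⟨le_max_right _ _, max_le (min_le_right _ _) ?_⟩) hψ
  linarith [M.cast_nonneg (α := ℝ)]

end Dual


/-! ### Existence of weak weak* derivatives -/

lemma ae_eq_of_forall_test (hΩ : IsOpen Ω) {a b : EuclideanSpace ℝ (Fin n) → ℝ}
    (ha : IntegrableOn a Ω) (hb : IntegrableOn b Ω)
    (h : ∀ ψ, IsTestFunction Ω ψ → ∫ x in Ω, ψ x * a x = ∫ x in Ω, ψ x * b x) :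
    a =ᵐ[volume.restrict Ω] b := by
  have h1 := ae_abs_le_of_forall_test (b := fun _ => 0) hΩ (ha.sub hb) integrableOn_zero
    fun ψ hψ _ => by
      have h2 := integral_sub (hψ.integrableOn_smul ha) (hψ.integrableOn_smul hb)
      simp only [smul_eq_mul, ← mul_sub] at h2
      simp [h2, h ψ hψ]
  filter_upwards [h1] with x hx
  exact sub_eq_zero.1 (abs_nonpos_iff.1 hx)

/-- A weak* ultralimit of bounded linear functionals. -/
lemma exists_strongDual_tendsto_ultrafilter {ι V : Type*} [NormedAddCommGroup V] [NormedSpace ℝ V]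
    (U : Ultrafilter ι) (T : ι → V →ₗ[ℝ] ℝ) {B : ι → ℝ} {b : ℝ}
    (hT : ∀ i v, |T i v| ≤ ‖v‖ * B i) (hB : Tendsto B U (𝓝 b)) (hb : 0 ≤ b) :
    ∃ Λ : StrongDual ℝ V, ‖Λ‖ ≤ b ∧ ∀ v, Tendsto (fun i => T i v) U (𝓝 (Λ v)) := by
  have hlim : ∀ v, ∃ y, Tendsto (fun i => T i v) U (𝓝 y) := by
    intro v
    -- The values eventually lie in one compact interval, so they converge along the ultrafilter.
    have hmem : Set.Icc (-(‖v‖ * (b + 1))) (‖v‖ * (b + 1)) ∈ U.map (fun i => T i v) := by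
      refine Ultrafilter.mem_map.2 ?_
      filter_upwards [hB.eventually_le_const (lt_add_one b)] with i hi
      exact abs_le.1 ((hT i v).trans (mul_le_mul_of_nonneg_left hi (norm_nonneg v)))
    obtain ⟨y, -, hy⟩ := isCompact_Icc.ultrafilter_le_nhds' _ hmem
    exact ⟨y, hy⟩
  choose l hl using hlim
  let Λ : V →ₗ[ℝ] ℝ :=
    { toFun := l
      map_add' := fun v w => tendsto_nhds_unique (hl (v + w))
        (by simpa only [map_add] using (hl v).add (hl w))
      map_smul' := fun c v => tendsto_nhds_unique (hl (c • v))
        (by simpa only [map_smul, RingHom.id_apply] using (hl v).const_smul c) }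
  have hΛ : ∀ v, ‖Λ v‖ ≤ b * ‖v‖ := fun v => by
    rw [mul_comm]
    exact le_of_tendsto_of_tendsto (hl v).abs (hB.const_mul _) (Eventually.of_forall fun i => hT i v)
  exact ⟨Λ.mkContinuous b hΛ, Λ.mkContinuous_norm_le hb hΛ, hl⟩

section Dual

variable {V : Type*} [NormedAddCommGroup V] [NormedSpace ℝ V]
  {f : EuclideanSpace ℝ (Fin n) → StrongDual ℝ V} {g : EuclideanSpace ℝ (Fin n) → ℝ} {j : Fin n}

lemma hasWeakWeakStarDeriv_of_forall (hf : IntegrableOn f Ω)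
    {f' : EuclideanSpace ℝ (Fin n) → StrongDual ℝ V}
    (hf' : ∀ v, IntegrableOn (fun x => f' x v) Ω)
    (h : ∀ v, HasWeakPartialDeriv Ω j (fun x => f x v) (fun x => f' x v)) :
    HasWeakWeakStarDeriv Ω j f f' := by
  intro ψ hψ
  have hint := hψ.integrableOn_partialDeriv_smul j hf
  refine ⟨∫ x in Ω, partialDeriv j ψ x • f x, fun v => ⟨hint.apply_continuousLinearMap v,
    ContinuousLinearMap.integral_apply hint v⟩, fun v => ⟨hψ.integrableOn_smul (hf' v), ?_⟩⟩
  rw [neg_apply, ContinuousLinearMap.integral_apply hint]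
  exact neg_eq_iff_eq_neg.2 ((h v).2.2 ψ hψ)

/-- Weak derivatives of the scalar components of a map assemble to a weak weak* derivative, the
linear representatives being obtained from ultralimits of mollifications. -/
theorem exists_hasWeakWeakStarDeriv_of_components (hΩ : IsOpen Ω) (hf : IntegrableOn f Ω)
    (hg : IntegrableOn g Ω) (hg0 : ∀ᵐ x ∂(volume.restrict Ω), 0 ≤ g x)
    (w : V → EuclideanSpace ℝ (Fin n) → ℝ)
    (hw : ∀ v, HasWeakPartialDeriv Ω j (fun x => f x v) (w v))
    (hwg : ∀ v, ∀ᵐ x ∂(volume.restrict Ω), |w v x| ≤ ‖v‖ * g x) :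
    ∃ f' : EuclideanSpace ℝ (Fin n) → StrongDual ℝ V, WeakStarMeasurable Ω f' ∧
      HasWeakWeakStarDeriv Ω j f f' ∧ (∀ᵐ x ∂(volume.restrict Ω), ‖f' x‖ ≤ g x) ∧
      ∀ x, ‖f' x‖ ≤ |g x| := by
  have hwi : ∀ v, IntegrableOn (w v) Ω := fun v =>
    (hg.const_mul ‖v‖).mono' (hw v).2.1.aestronglyMeasurable (hwg v)
  have hfv : ∀ v, IntegrableOn (fun x => f x v) Ω := fun v => hf.apply_continuousLinearMap v
  have hηi : ∀ (k : ℕ) (x : EuclideanSpace ℝ (Fin n)) {a : EuclideanSpace ℝ (Fin n) → ℝ},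
      IntegrableOn a Ω → IntegrableOn (fun y => mollifier n k (x - y) * a y) Ω := by
    intro k x a ha
    have hc : Continuous (mollifier n k) := (contDiff_mollifier n k (m := 0)).continuous
    obtain ⟨C, hC⟩ := (hasCompactSupport_mollifier n k).exists_bound_of_continuous hc
    exact ha.bdd_mul (c := C)
      (hc.comp (continuous_const.sub continuous_id)).aestronglyMeasurable
      (Eventually.of_forall fun y => hC _)
  have hadd : ∀ v v', w (v + v') =ᵐ[volume.restrict Ω] w v + w v' := fun v v' => by
    refine ae_eq_of_forall_test hΩ (hwi _) ((hwi v).add (hwi v')) fun ψ hψ => ?_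
    have h1 := integral_add (hψ.integrableOn_partialDeriv_smul j (hfv v))
      (hψ.integrableOn_partialDeriv_smul j (hfv v'))
    have h2 := integral_add (hψ.integrableOn_smul (hwi v)) (hψ.integrableOn_smul (hwi v'))
    have h3 := (hw (v + v')).2.2 ψ hψ
    simp only [smul_eq_mul, ← mul_add] at h1 h2
    simp only [map_add] at h3
    simp only [Pi.add_apply]
    linarith [(hw v).2.2 ψ hψ, (hw v').2.2 ψ hψ]
  have hsmul : ∀ (c : ℝ) v, w (c • v) =ᵐ[volume.restrict Ω] c • w v := fun c v => by
    refine ae_eq_of_forall_test hΩ (hwi _) ((hwi v).smul c) fun ψ hψ => ?_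
    have h3 := (hw (c • v)).2.2 ψ hψ
    simp only [map_smul, smul_eq_mul, mul_left_comm _ c, integral_const_mul] at h3
    simp only [Pi.smul_apply, smul_eq_mul, mul_left_comm _ c, integral_const_mul]
    rw [(hw v).2.2 ψ hψ] at h3
    linarith
  -- Integration absorbs the null sets in `hadd` and `hsmul`: the mollified components are linear in
  -- `v` at every `x`.
  let T : EuclideanSpace ℝ (Fin n) → ℕ → V →ₗ[ℝ] ℝ := fun x k =>
    { toFun := fun v => ∫ y in Ω, mollifier n k (x - y) * w v y
      map_add' := fun v v' => by
        rw [← integral_add (hηi k x (hwi v)) (hηi k x (hwi v'))]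
        refine integral_congr_ae ?_
        filter_upwards [hadd v v'] with y hy
        rw [hy, Pi.add_apply, mul_add]
      map_smul' := fun c v => by
        rw [RingHom.id_apply, smul_eq_mul, ← integral_const_mul]
        refine integral_congr_ae ?_
        filter_upwards [hsmul c v] with y hy
        rw [hy, Pi.smul_apply, smul_eq_mul, mul_left_comm] }
  let B : EuclideanSpace ℝ (Fin n) → ℕ → ℝ := fun x k => ∫ y in Ω, mollifier n k (x - y) * g y
  have hTB : ∀ x k v, |T x k v| ≤ ‖v‖ * B x k := fun x k v => by
    simp only [B, ← integral_const_mul]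
    rw [← Real.norm_eq_abs]
    refine norm_integral_le_of_norm_le ((hηi k x hg).const_mul ‖v‖) ?_
    filter_upwards [hwg v] with y hy
    rw [norm_mul, Real.norm_of_nonneg (mollifier_nonneg n k _), mul_left_comm]
    exact mul_le_mul_of_nonneg_left hy (mollifier_nonneg n k _)
  let U : Ultrafilter ℕ := hyperfilter ℕ
  have hU : (U : Filter ℕ) ≤ atTop := Nat.hyperfilter_le_atTop
  -- At bad points the value is 0, so that `‖f' x‖ ≤ |g x|` holds everywhere; upper integrals need a
  -- majorant at every point.
  have hpoint : ∀ x, ∃ Λ : StrongDual ℝ V, ‖Λ‖ ≤ |g x| ∧ (0 ≤ g x → Tendsto (B x) U (𝓝 (g x)) →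
      ‖Λ‖ ≤ g x ∧ ∀ v, Tendsto (fun k => T x k v) U (𝓝 (Λ v))) := fun x => by
    by_cases h : 0 ≤ g x ∧ Tendsto (B x) U (𝓝 (g x))
    · obtain ⟨Λ, hΛ, hlim⟩ := exists_strongDual_tendsto_ultrafilter U (T x) (hTB x) h.2 h.1
      exact ⟨Λ, hΛ.trans (le_abs_self _), fun _ _ => ⟨hΛ, hlim⟩⟩
    · exact ⟨0, by simp, fun h1 h2 => absurd ⟨h1, h2⟩ h⟩
  choose f' hf' hlim using hpoint
  -- This exceptional set depends on `g` alone, not on `v`.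
  have hgood : ∀ᵐ x ∂(volume.restrict Ω), ‖f' x‖ ≤ g x ∧
      ∀ v, Tendsto (fun k => T x k v) U (𝓝 (f' x v)) := by
    filter_upwards [ae_tendsto_setIntegral_mollifier hΩ hg, hg0] with x hx hx0
    exact hlim x hx0 (hx.mono_left hU)
  -- Here the null set may depend on `v`, which is harmless because weak weak* derivatives are
  -- tested one `v` at a time.
  have hae : ∀ v, w v =ᵐ[volume.restrict Ω] fun x => f' x v := fun v => by
    filter_upwards [hgood, ae_tendsto_setIntegral_mollifier hΩ (hwi v)] with x hx hxw
    exact tendsto_nhds_unique (hxw.mono_left hU) (hx.2 v)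
  have hf'i : ∀ v, IntegrableOn (fun x => f' x v) Ω := fun v => (hwi v).congr (hae v)
  refine ⟨f', fun v => (hf'i v).aemeasurable, ?_, hgood.mono fun x hx => hx.1, hf'⟩
  refine hasWeakWeakStarDeriv_of_forall hf hf'i fun v =>
    ⟨(hw v).1, (hf'i v).locallyIntegrableOn, fun ψ hψ => ?_⟩
  rw [(hw v).2.2 ψ hψ]
  congr 1
  refine integral_congr_ae ?_
  filter_upwards [hae v] with x hx
  rw [hx]

end Dual

variable {p : ℝ≥0∞}

/-! ### Integrability -/

lemma isFiniteMeasure_restrict_of_isBounded (hbdd : Bornology.IsBounded Ω) :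
    IsFiniteMeasure (volume.restrict Ω) :=
  ⟨by simpa using hbdd.measure_lt_top⟩

lemma MemLpMetric.memLp {F : Type*} [NormedAddCommGroup F] {f : EuclideanSpace ℝ (Fin n) → F}
    (hf : MemLpMetric Ω p f) : MemLp f p (volume.restrict Ω) := by
  rw [← memLp_norm_iff hf.1]
  simpa using hf.2 0

lemma MemLpMetric.integrableOn {F : Type*} [NormedAddCommGroup F]
    {f : EuclideanSpace ℝ (Fin n) → F} (hbdd : Bornology.IsBounded Ω) (hp : 1 ≤ p)
    (hf : MemLpMetric Ω p f) : IntegrableOn f Ω :=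
  have := isFiniteMeasure_restrict_of_isBounded hbdd
  hf.memLp.integrable hp

lemma MemLpMetric.lipschitz_comp {X Y : Type*} [MetricSpace X] [MetricSpace Y] [Nonempty X]
    {f : EuclideanSpace ℝ (Fin n) → X} (hbdd : Bornology.IsBounded Ω)
    (hf : MemLpMetric Ω p f) {L : ℝ≥0} {φ : X → Y} (hφ : LipschitzWith L φ) :
    MemLpMetric Ω p (φ ∘ f) := by
  have := isFiniteMeasure_restrict_of_isBounded hbdd
  have hm := hφ.continuous.comp_aestronglyMeasurable hf.1
  refine ⟨hm, fun y => ?_⟩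
  obtain ⟨z⟩ := ‹Nonempty X›
  refine (((hf.2 z).const_mul (L : ℝ)).add (memLp_const (dist (φ z) y))).mono'
    (hm.dist aestronglyMeasurable_const) (Eventually.of_forall fun x => ?_)
  rw [Real.norm_of_nonneg dist_nonneg]
  exact (dist_triangle _ (φ z) _).trans (add_le_add_left (hφ.dist_le_mul _ _) _)

lemma upperIntegral_le {F h : EuclideanSpace ℝ (Fin n) → ℝ} (hh : IntegrableOn h Ω)
    (hF : ∀ x ∈ Ω, F x ≤ h x) : upperIntegral Ω F ≤ ENNReal.ofReal (∫ x in Ω, h x) :=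
  (iInf_le _ h).trans (iInf₂_le hh hF)

lemma exists_majorant_of_upperIntegral_lt_top {F : EuclideanSpace ℝ (Fin n) → ℝ}
    (h : upperIntegral Ω F < ⊤) :
    ∃ h : EuclideanSpace ℝ (Fin n) → ℝ, IntegrableOn h Ω ∧ ∀ x ∈ Ω, F x ≤ h x := by
  simp only [upperIntegral, iInf_lt_iff] at h
  obtain ⟨h, hh, hF, -⟩ := h
  exact ⟨h, hh, hF⟩

lemma abs_rpow_one_div_rpow (hp : 1 < p) (hp' : p < ⊤) (a : ℝ) :
    ‖|a| ^ (1 / p.toReal)‖ ^ p.toReal = |a| := by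
  have hp0 : p.toReal ≠ 0 := (ENNReal.toReal_pos (by positivity) hp'.ne).ne'
  rw [Real.norm_of_nonneg (by positivity), ← Real.rpow_mul (abs_nonneg a), one_div_mul_cancel hp0,
    Real.rpow_one]

/-- Turns an integrable majorant of `‖F‖ ^ p` into an `L^p` majorant of `‖F‖`. The absolute value is
there because `h` may be negative outside `Ω`. -/
lemma memLp_abs_rpow_one_div (hp : 1 < p) (hp' : p < ⊤) {h : EuclideanSpace ℝ (Fin n) → ℝ}
    (hh : IntegrableOn h Ω) :
    MemLp (fun x => |h x| ^ (1 / p.toReal)) p (volume.restrict Ω) := by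
  have hm : AEStronglyMeasurable (fun x => |h x| ^ (1 / p.toReal)) (volume.restrict Ω) :=
    (Real.continuous_rpow_const (by positivity)).comp_aestronglyMeasurable
      hh.aestronglyMeasurable.norm
  rw [← integrable_norm_rpow_iff hm (by positivity) hp'.ne]
  simp_rw [abs_rpow_one_div_rpow hp hp']
  exact hh.abs

lemma eLpNorm_abs_rpow_one_div (hp : 1 < p) (hp' : p < ⊤) {h : EuclideanSpace ℝ (Fin n) → ℝ}
    (hh : IntegrableOn h Ω) :
    eLpNorm (fun x => |h x| ^ (1 / p.toReal)) p (volume.restrict Ω) =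
      ENNReal.ofReal (∫ x in Ω, |h x|) ^ p.toReal⁻¹ := by
  rw [(memLp_abs_rpow_one_div hp hp' hh).eLpNorm_eq_integral_rpow_norm (by positivity) hp'.ne]
  simp_rw [abs_rpow_one_div_rpow hp hp']
  rw [ENNReal.ofReal_rpow_of_nonneg (integral_nonneg fun x => abs_nonneg _) (by positivity)]

lemma le_abs_rpow_one_div (hp : 1 < p) (hp' : p < ⊤) {a b : ℝ} (ha : 0 ≤ a)
    (h : a ^ p.toReal ≤ b) : a ≤ |b| ^ (1 / p.toReal) := by
  have hp0 : 0 < p.toReal := ENNReal.toReal_pos (by positivity) hp'.ne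
  rw [one_div, Real.le_rpow_inv_iff_of_pos ha (abs_nonneg b) hp0]
  exact h.trans (le_abs_self b)

/-- The source of every `√n`: the optimal factor `n ^ (1 / q)` is at most `√n` when `q ≥ 2`. -/
lemma norm_toLp_le_sqrt_mul {W : Type*} [NormedAddCommGroup W] (hn : 1 ≤ n) {q : ℝ≥0∞}
    (hq : 2 ≤ q) {a : Fin n → W} {c : ℝ} (ha : ∀ i, ‖a i‖ ≤ c) :
    ‖WithLp.toLp q a‖ ≤ √n * c := by
  have : Nonempty (Fin n) := ⟨⟨0, hn⟩⟩
  have hc : 0 ≤ c := (norm_nonneg _).trans (ha ⟨0, hn⟩)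
  have hn' : (1 : ℝ) ≤ n := by exact_mod_cast hn
  rcases eq_or_ne q ⊤ with rfl | hqT
  · rw [PiLp.norm_eq_ciSup]
    exact (ciSup_le ha).trans (le_mul_of_one_le_left hc (Real.one_le_sqrt.2 hn'))
  · have hq2 : 2 ≤ q.toReal := by simpa using ENNReal.toReal_mono hqT hq
    have hq0 : 0 < q.toReal := by linarith
    rw [PiLp.norm_eq_sum hq0]
    calc (∑ i, ‖a i‖ ^ q.toReal) ^ (1 / q.toReal)
        ≤ (∑ _i : Fin n, c ^ q.toReal) ^ (1 / q.toReal) := by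
          gcongr with i
          exact ha i
      _ = (n : ℝ) ^ (1 / q.toReal) * c := by
          rw [Finset.sum_const, Finset.card_univ, Fintype.card_fin, nsmul_eq_mul,
            Real.mul_rpow (by positivity) (by positivity), ← Real.rpow_mul hc,
            mul_one_div_cancel hq0.ne', Real.rpow_one]
      _ ≤ √n * c := by
          rw [Real.sqrt_eq_rpow]
          gcongr

section Dual

variable {V : Type*} [NormedAddCommGroup V] [NormedSpace ℝ V]
  {f : EuclideanSpace ℝ (Fin n) → StrongDual ℝ V}

/-! ### From weak weak* derivatives to Reshetnyak upper gradients -/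

lemma exists_hasWeakPartialDeriv_lipschitz_comp (hΩ : IsOpen Ω) (hbdd : Bornology.IsBounded Ω)
    (hp : 1 < p) (hf : MemLpMetric Ω p f)
    {F : Fin n → EuclideanSpace ℝ (Fin n) → StrongDual ℝ V}
    (hF : ∀ j, HasWeakWeakStarDeriv Ω j f (F j)) {h : EuclideanSpace ℝ (Fin n) → ℝ}
    (hh : MemLp h p (volume.restrict Ω)) (hFh : ∀ j, ∀ x ∈ Ω, ‖F j x‖ ≤ h x)
    {L : ℝ≥0} {φ : StrongDual ℝ V → ℝ} (hφ : LipschitzWith L φ) (j : Fin n) :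
    ∃ u' : EuclideanSpace ℝ (Fin n) → ℝ, MemLp u' p (volume.restrict Ω) ∧
      HasWeakPartialDeriv Ω j (φ ∘ f) u' ∧ ∀ᵐ x ∂(volume.restrict Ω), |u' x| ≤ L * h x := by
  have := isFiniteMeasure_restrict_of_isBounded hbdd
  have hhi : IntegrableOn h Ω := hh.integrable hp.le
  have hφi : IntegrableOn (φ ∘ f) Ω := (hf.lipschitz_comp hbdd hφ).integrableOn hbdd hp.le
  have hh0 : ∀ᵐ x ∂(volume.restrict Ω), 0 ≤ h x := by
    filter_upwards [ae_restrict_mem hΩ.measurableSet] with x hx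
    exact (norm_nonneg _).trans (hFh j x hx)
  obtain ⟨u', hu'i, hu', hle⟩ := exists_hasWeakPartialDeriv_of_test_bound hΩ j hφi hhi hh0 L.2
    fun ψ hψ => abs_integral_partialDeriv_comp_le hΩ hbdd (hf.integrableOn hbdd hp.le) (hF j) hhi
      (hFh j) hφ hφi hψ
  exact ⟨u', (hh.const_mul (L : ℝ)).mono' hu'i.aestronglyMeasurable hle, hu', hle⟩

lemma isReshetnyakUpperGradient_of_hasWeakWeakStarDeriv (hn : 1 ≤ n) (hΩ : IsOpen Ω)
    (hbdd : Bornology.IsBounded Ω) (hp : 1 < p) (hf : MemLpMetric Ω p f)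
    {F : Fin n → EuclideanSpace ℝ (Fin n) → StrongDual ℝ V}
    (hF : ∀ j, HasWeakWeakStarDeriv Ω j f (F j)) {h : EuclideanSpace ℝ (Fin n) → ℝ}
    (hh : MemLp h p (volume.restrict Ω)) (hFh : ∀ j, ∀ x ∈ Ω, ‖F j x‖ ≤ h x) :
    IsReshetnyakUpperGradient Ω p f (fun x => √n * h x) := by
  refine ⟨hh.const_mul _, fun L φ hφ => ?_⟩
  choose u' _ hu' hle using
    exists_hasWeakPartialDeriv_lipschitz_comp hΩ hbdd hp hf hF hh hFh hφ
  refine ⟨fun x => WithLp.toLp 2 fun j => u' j x, hu', ?_⟩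
  filter_upwards [ae_all_iff.2 hle] with x hx
  rw [mul_left_comm]
  exact norm_toLp_le_sqrt_mul hn le_rfl hx

theorem sobolevStar_subset_sobolevReshetnyak (hn : 1 ≤ n) (hΩ : IsOpen Ω)
    (hbdd : Bornology.IsBounded Ω) (hp : 1 < p) (hp' : p < ⊤) :
    sobolevStar V Ω p ⊆ sobolevReshetnyak Ω p (StrongDual ℝ V) := by
  rintro f ⟨hf, hder⟩
  choose F hF hFd using hder
  choose h hh hFh using fun j => exists_majorant_of_upperIntegral_lt_top (hF j).2
  -- Summing over `j` gives one `L^p` majorant for all the derivatives.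
  have hmem : MemLp (fun x => ∑ j, |h j x| ^ (1 / p.toReal)) p (volume.restrict Ω) :=
    memLp_finsetSum _ fun j _ => memLp_abs_rpow_one_div hp hp' (hh j)
  have hle : ∀ j, ∀ x ∈ Ω, ‖F j x‖ ≤ ∑ j, |h j x| ^ (1 / p.toReal) := fun j x hx =>
    (le_abs_rpow_one_div hp hp' (norm_nonneg _) (hFh j x hx)).trans
      (Finset.single_le_sum (f := fun j => |h j x| ^ (1 / p.toReal))
        (fun i _ => by positivity) (Finset.mem_univ j))
  refine ⟨hf, fun L φ hφ => ⟨(hf.lipschitz_comp hbdd hφ).memLp, fun j => ?_⟩, _,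
    isReshetnyakUpperGradient_of_hasWeakWeakStarDeriv hn hΩ hbdd hp hf hFd hmem hle⟩
  obtain ⟨u', hu', hd, -⟩ :=
    exists_hasWeakPartialDeriv_lipschitz_comp hΩ hbdd hp hf hFd hmem hle hφ j
  exact ⟨u', hu', hd⟩

/-! ### From Reshetnyak upper gradients to weak weak* derivatives -/

/-- The zero function counts as 1-Lipschitz, and the norm of its weak gradient is then at most `g`.
-/
lemma IsReshetnyakUpperGradient.nonneg {X : Type*} [MetricSpace X] [Nonempty X]
    {f : EuclideanSpace ℝ (Fin n) → X} {g : EuclideanSpace ℝ (Fin n) → ℝ}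
    (hg : IsReshetnyakUpperGradient Ω p f g) : ∀ᵐ x ∂(volume.restrict Ω), 0 ≤ g x := by
  obtain ⟨G, -, hG⟩ := hg.2 1 (fun _ => 0) (LipschitzWith.const' 0)
  filter_upwards [hG] with x hx
  simpa using (norm_nonneg _).trans hx

/-- The upper gradient property is applied to the evaluations at `v`, which are `‖v‖`-Lipschitz. The
everywhere bound by `|g|` gives membership in `L^p_*` and is reused for the norm comparison. -/
theorem IsReshetnyakUpperGradient.exists_hasWeakWeakStarDeriv (hΩ : IsOpen Ω)
    (hbdd : Bornology.IsBounded Ω) (hp : 1 < p) (hp' : p < ⊤) (hf : MemLpMetric Ω p f)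
    {g : EuclideanSpace ℝ (Fin n) → ℝ} (hg : IsReshetnyakUpperGradient Ω p f g) (j : Fin n) :
    ∃ f' : EuclideanSpace ℝ (Fin n) → StrongDual ℝ V, MemLpStar Ω p f' ∧
      HasWeakWeakStarDeriv Ω j f f' ∧ (∀ᵐ x ∂(volume.restrict Ω), ‖f' x‖ ≤ g x) ∧
      ∀ x, ‖f' x‖ ≤ |g x| := by
  have := isFiniteMeasure_restrict_of_isBounded hbdd
  have heval : ∀ v : V, LipschitzWith ‖v‖₊ (fun z : StrongDual ℝ V => z v) := fun v =>
    LipschitzWith.of_dist_le_mul fun z z' => by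
      rw [dist_eq_norm, dist_eq_norm, ← sub_apply, mul_comm]
      exact (z - z').le_opNorm v
  choose G hG hGle using fun v => hg.2 _ _ (heval v)
  obtain ⟨f', hm, hd, hle, hle'⟩ := exists_hasWeakWeakStarDeriv_of_components hΩ
    (hf.integrableOn hbdd hp.le) (hg.1.integrable hp.le) hg.nonneg (fun v x => G v x j)
    (fun v => hG v j) fun v => (hGle v).mono fun x hx => (PiLp.norm_apply_le (G v x) j).trans hx
  refine ⟨f', ⟨hm, ?_⟩, hd, hle, hle'⟩
  refine (upperIntegral_le (hg.1.integrable_norm_rpow (by positivity) hp'.ne)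
    fun x _ => ?_).trans_lt ENNReal.ofReal_lt_top
  gcongr
  exact hle' x

theorem sobolevReshetnyak_subset_sobolevStar (hΩ : IsOpen Ω)
    (hbdd : Bornology.IsBounded Ω) (hp : 1 < p) (hp' : p < ⊤) :
    sobolevReshetnyak Ω p (StrongDual ℝ V) ⊆ sobolevStar V Ω p := by
  rintro f ⟨hf, -, g, hg⟩
  refine ⟨hf, fun j => ?_⟩
  obtain ⟨f', h1, h2, -⟩ := hg.exists_hasWeakWeakStarDeriv hΩ hbdd hp hp' hf j
  exact ⟨f', h1, h2⟩

/-! ### Comparison of the norms -/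

theorem ofReal_mul_normReshetnyak_le_normStar (hn : 1 ≤ n) (hΩ : IsOpen Ω)
    (hbdd : Bornology.IsBounded Ω) (hp : 1 < p) (hp' : p < ⊤) (hf : MemLpMetric Ω p f)
    {q : ℝ≥0∞} (hq : 2 ≤ q) :
    ENNReal.ofReal (1 / √n) * normReshetnyak Ω p f ≤ normStar Ω p q f := by
  have hp0 : 0 < p.toReal := ENNReal.toReal_pos (by positivity) hp'.ne
  have : Fact (1 ≤ q) := ⟨one_le_two.trans hq⟩
  have hn' : 1 ≤ √(n : ℝ) := Real.one_le_sqrt.2 (by exact_mod_cast hn)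
  rw [normReshetnyak, normStar, mul_add]
  refine add_le_add (mul_le_of_le_one_left' ?_) (le_iInf₂ fun F hF => ?_)
  · rw [ENNReal.ofReal_le_one]
    exact div_le_one_of_le₀ hn' (by positivity)
  -- Moving the `p`-th root to the other side exposes the infimum over majorants, so a single `h`
  -- can be treated.
  rw [one_div p.toReal, ENNReal.le_rpow_inv_iff hp0]
  refine le_iInf fun h => le_iInf₂ fun hh hFh => ?_
  have hle : ∀ j, ∀ x ∈ Ω, ‖F j x‖ ≤ |h x| ^ (1 / p.toReal) := fun j x hx =>
    (PiLp.norm_apply_le (WithLp.toLp q fun j => F j x) j).trans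
      (le_abs_rpow_one_div hp hp' (norm_nonneg _) (hFh x hx))
  have hgrad := isReshetnyakUpperGradient_of_hasWeakWeakStarDeriv hn hΩ hbdd hp hf
    (fun j => (hF j).2) (memLp_abs_rpow_one_div hp hp' hh) hle
  have habs : ∫ x in Ω, |h x| = ∫ x in Ω, h x :=
    setIntegral_congr_fun hΩ.measurableSet fun x hx =>
      abs_of_nonneg ((Real.rpow_nonneg (norm_nonneg _) _).trans (hFh x hx))
  rw [← habs, ← ENNReal.le_rpow_inv_iff hp0, ← eLpNorm_abs_rpow_one_div hp hp' hh]
  calc _ ≤ ENNReal.ofReal (1 / √n) *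
        eLpNorm (fun x => √n * |h x| ^ (1 / p.toReal)) p (volume.restrict Ω) := by
        gcongr
        exact iInf₂_le _ hgrad
    _ = _ := by
        rw [show (fun x => √n * |h x| ^ (1 / p.toReal)) =
          √(n : ℝ) • fun x => |h x| ^ (1 / p.toReal) from rfl, eLpNorm_const_smul, ← mul_assoc,
          Real.enorm_of_nonneg (by positivity), ← ENNReal.ofReal_mul (by positivity),
          one_div_mul_cancel (by positivity), ENNReal.ofReal_one, one_mul]

theorem normStar_le_ofReal_mul_normReshetnyak (hn : 1 ≤ n) (hΩ : IsOpen Ω)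
    (hbdd : Bornology.IsBounded Ω) (hp : 1 < p) (hp' : p < ⊤) (hf : MemLpMetric Ω p f)
    {q : ℝ≥0∞} (hq : 2 ≤ q) :
    normStar Ω p q f ≤ ENNReal.ofReal √n * normReshetnyak Ω p f := by
  have hn' : 1 ≤ √(n : ℝ) := Real.one_le_sqrt.2 (by exact_mod_cast hn)
  have hs : ENNReal.ofReal √(n : ℝ) ≠ 0 := by
    rw [Ne, ENNReal.ofReal_eq_zero]
    linarith
  rw [normReshetnyak, normStar, mul_add]
  refine add_le_add (le_mul_of_one_le_left' (by simpa using ENNReal.ofReal_le_ofReal hn')) ?_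
  -- Dividing by `√n` leaves the infimum over `g` alone on the right, where it can be tested on one
  -- `g`.
  refine (ENNReal.inv_mul_le_iff hs ENNReal.ofReal_ne_top).1 (le_iInf₂ fun g hg => ?_)
  refine (ENNReal.inv_mul_le_iff hs ENNReal.ofReal_ne_top).2 ?_
  choose F hF hFd _ hFle using hg.exists_hasWeakWeakStarDeriv hΩ hbdd hp hp' hf
  have hgn : MemLp (√(n : ℝ) • g) p (volume.restrict Ω) := hg.1.const_smul _
  refine (iInf₂_le F fun j => ⟨hF j, hFd j⟩).trans ?_
  calc _ ≤ ENNReal.ofReal (∫ x in Ω, ‖(√(n : ℝ) • g) x‖ ^ p.toReal) ^ (1 / p.toReal) := by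
        gcongr
        refine upperIntegral_le (hgn.integrable_norm_rpow (by positivity) hp'.ne) fun x _ => ?_
        have : Fact (1 ≤ q) := ⟨one_le_two.trans hq⟩
        refine Real.rpow_le_rpow (norm_nonneg _) ?_ ENNReal.toReal_nonneg
        rw [Pi.smul_apply, norm_smul, Real.norm_of_nonneg (Real.sqrt_nonneg _)]
        exact norm_toLp_le_sqrt_mul hn hq fun j => hFle j x
    _ = eLpNorm (√(n : ℝ) • g) p (volume.restrict Ω) := by
        rw [hgn.eLpNorm_eq_integral_rpow_norm (by positivity) hp'.ne, one_div,
          ENNReal.ofReal_rpow_of_nonneg (integral_nonneg fun x => by positivity) (by positivity)]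
    _ = _ := by rw [eLpNorm_const_smul, Real.enorm_of_nonneg (Real.sqrt_nonneg _)]

end Dual

/-! ### Isometric embeddings -/

/-- By McShane, a Lipschitz function on the image of `ι` extends to `Y` with the same constant, so
`u` and `ι ∘ u` share their upper gradients. -/
theorem comp_mem_sobolevReshetnyak_iff {X Y : Type*} [MetricSpace X] [MetricSpace Y]
    (hbdd : Bornology.IsBounded Ω) {ι : X → Y} (hι : Isometry ι)
    {u : EuclideanSpace ℝ (Fin n) → X} :
    ι ∘ u ∈ sobolevReshetnyak Ω p Y ↔ u ∈ sobolevReshetnyak Ω p X := by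
  have : Nonempty X := ⟨u 0⟩
  have hext : ∀ (L : ℝ≥0) (φ : X → ℝ), LipschitzWith L φ →
      ∃ Φ : Y → ℝ, LipschitzWith L Φ ∧ Φ ∘ (ι ∘ u) = φ ∘ u := fun L φ hφ => by
    have hinv : ∀ x, Function.invFun ι (ι x) = x := Function.leftInverse_invFun hι.injective
    obtain ⟨Φ, hΦ, heq⟩ := LipschitzOnWith.extend_real (f := φ ∘ Function.invFun ι)
      (s := Set.range ι) (K := L) (LipschitzOnWith.of_dist_le_mul (by
        rintro _ ⟨x, rfl⟩ _ ⟨y, rfl⟩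
        rw [Function.comp_apply, Function.comp_apply, hinv, hinv, hι.dist_eq]
        exact hφ.dist_le_mul x y))
    refine ⟨Φ, hΦ, funext fun x => ?_⟩
    rw [Function.comp_apply, Function.comp_apply, ← heq ⟨u x, rfl⟩, Function.comp_apply, hinv]
    rfl
  have hcomp : ∀ (L : ℝ≥0) (φ : Y → ℝ), LipschitzWith L φ → LipschitzWith L (φ ∘ ι) :=
    fun L φ hφ => by simpa using hφ.comp hι.lipschitz
  constructor
  · rintro ⟨hm, hs, g, hg, hgrad⟩
    refine ⟨⟨hι.isEmbedding.aestronglyMeasurable_comp_iff.1 hm.1, fun z => ?_⟩,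
      fun L φ hφ => ?_, g, hg, fun L φ hφ => ?_⟩
    · simpa [hι.dist_eq] using hm.2 (ι z)
    · obtain ⟨Φ, hΦ, heq⟩ := hext L φ hφ
      exact heq ▸ hs L Φ hΦ
    · obtain ⟨Φ, hΦ, heq⟩ := hext L φ hφ
      exact heq ▸ hgrad L Φ hΦ
  · rintro ⟨hm, hs, g, hg, hgrad⟩
    exact ⟨hm.lipschitz_comp hbdd hι.lipschitz, fun L φ hφ => hs L _ (hcomp L φ hφ), g, hg,
      fun L φ hφ => hgrad L _ (hcomp L φ hφ)⟩

/-- The Kuratowski embedding of a metric space into its bounded continuous functions. -/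
theorem exists_isometry_boundedContinuousFunction (X : Type v) [MetricSpace X] :
    ∃ κ : X → BoundedContinuousFunction X ℝ, Isometry κ := by
  rcases isEmpty_or_nonempty X with hX | ⟨⟨x₀⟩⟩
  · exact ⟨fun x => (hX.false x).elim, fun x => (hX.false x).elim⟩
  let κ : X → BoundedContinuousFunction X ℝ := fun x =>
    -- Subtracting `dist x₀ y` makes the distance function bounded, by `dist x x₀`.
    BoundedContinuousFunction.ofNormedAddCommGroup (fun y => dist x y - dist x₀ y)
      (by fun_prop) (dist x x₀) fun y => abs_dist_sub_le x x₀ y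
  refine ⟨κ, Isometry.of_dist_eq fun x y => le_antisymm ?_ ?_⟩
  · refine (BoundedContinuousFunction.dist_le dist_nonneg).2 fun z => ?_
    simp only [κ, BoundedContinuousFunction.coe_ofNormedAddCommGroup, Real.dist_eq,
      sub_sub_sub_cancel_right]
    exact abs_dist_sub_le x y z
  -- Evaluation at `y` itself attains the distance.
  · have := BoundedContinuousFunction.dist_coe_le_dist (f := κ x) (g := κ y) y
    simpa [κ, Real.dist_eq] using this

/-- The predual `W` is itself the dual of the bounded continuous functions, so its dual is their
bidual. -/
theorem exists_isometry_strongDual (X : Type v) [MetricSpace X] :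
    ∃ (W : Type v) (_ : NormedAddCommGroup W) (_ : NormedSpace ℝ W) (_ : CompleteSpace W)
      (ι : X → StrongDual ℝ W), Isometry ι := by
  obtain ⟨κ, hκ⟩ := exists_isometry_boundedContinuousFunction X
  exact ⟨StrongDual ℝ (BoundedContinuousFunction X ℝ), inferInstance, inferInstance,
    inferInstance, _, (NormedSpace.inclusionInDoubleDualLi ℝ).isometry.comp hκ⟩

end WeakStarSobolev

end

theorem theorem1p2 {n : ℕ} (hn : 1 ≤ n) (Ω : Set (EuclideanSpace ℝ (Fin n)))
    (hΩ_open : IsOpen Ω) (hΩ_conn : IsConnected Ω) (hΩ_bdd : Bornology.IsBounded Ω)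
    (p : ℝ≥0∞) (hp : 1 < p) (hp' : p < ⊤)
    (V : Type u) [NormedAddCommGroup V] [NormedSpace ℝ V] [CompleteSpace V]
    (X : Type v) [MetricSpace X] [CompleteSpace X] :
    -- equality of the two Sobolev spaces
    WeakStarSobolev.sobolevStar V Ω p = WeakStarSobolev.sobolevReshetnyak Ω p (StrongDual ℝ V) ∧
    -- each Reshetnyak upper gradient bounds suitable weak weak* derivatives
    (∀ f ∈ WeakStarSobolev.sobolevReshetnyak Ω p (StrongDual ℝ V),
      ∀ g, WeakStarSobolev.IsReshetnyakUpperGradient Ω p f g →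
        ∀ j : Fin n, ∃ f' : EuclideanSpace ℝ (Fin n) → StrongDual ℝ V,
          WeakStarSobolev.MemLpStar Ω p f' ∧
          WeakStarSobolev.HasWeakWeakStarDeriv Ω j f f' ∧
          ∀ᵐ x ∂(volume.restrict Ω), ‖f' x‖ ≤ g x) ∧
    -- equivalence of the Sobolev norms, up to factors `√n`
    (∀ f ∈ WeakStarSobolev.sobolevReshetnyak Ω p (StrongDual ℝ V), ∀ q : ℝ≥0∞, 2 ≤ q →
      ENNReal.ofReal (1 / √(n : ℝ)) * WeakStarSobolev.normReshetnyak Ω p f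
          ≤ WeakStarSobolev.normStar Ω p q f ∧
      WeakStarSobolev.normStar Ω p q f
          ≤ ENNReal.ofReal √(n : ℝ) * WeakStarSobolev.normReshetnyak Ω p f) ∧
    -- characterization of metric-space-valued Sobolev maps
    (∀ ι : X → StrongDual ℝ V, Isometry ι →
      {u : EuclideanSpace ℝ (Fin n) → X | ι ∘ u ∈ WeakStarSobolev.sobolevStar V Ω p} =
        WeakStarSobolev.sobolevReshetnyak Ω p X) ∧
    -- an isometric embedding into a dual Banach space always exists
    (∃ (W : Type v) (_ : NormedAddCommGroup W) (_ : NormedSpace ℝ W) (_ : CompleteSpace W)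
      (ι : X → StrongDual ℝ W), Isometry ι) := by
  have heq := Set.Subset.antisymm
    (WeakStarSobolev.sobolevStar_subset_sobolevReshetnyak (V := V) hn hΩ_open hΩ_bdd hp hp')
    (WeakStarSobolev.sobolevReshetnyak_subset_sobolevStar hΩ_open hΩ_bdd hp hp')
  refine ⟨heq, fun f hf g hg j => ?_, fun f hf q hq =>
    ⟨WeakStarSobolev.ofReal_mul_normReshetnyak_le_normStar hn hΩ_open hΩ_bdd hp hp' hf.1 hq,
      WeakStarSobolev.normStar_le_ofReal_mul_normReshetnyak hn hΩ_open hΩ_bdd hp hp' hf.1 hq⟩,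
    fun ι hι => ?_, WeakStarSobolev.exists_isometry_strongDual X⟩
  · obtain ⟨f', h1, h2, h3, -⟩ := hg.exists_hasWeakWeakStarDeriv hΩ_open hΩ_bdd hp hp' hf.1 j
    exact ⟨f', h1, h2, h3⟩
  · ext u
    rw [heq]
    exact WeakStarSobolev.comp_mem_sobolevReshetnyak_iff hΩ_bdd hι
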